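/- Let $(R,\mathfrak m,k)$ be a Noetherian local ring of positive dimension $d$ with infinite residue field. Let $F_1,\dots,F_q$ be finitely generated free $R$-modules of ranks $r_1,\dots,r_q$, and let $M_k\subseteq F_k$ be submodules of finite colength (that is, $F_k/M_k$ has finite length). For a submodule $N\subseteq F_k$ write $S_n(N)$ for the image of the $n$-th symmetric power of $N$ in the symmetric algebra $S(F_1\oplus\cdots\oplus F_q)$. A collection of submodules $B_k\subseteq M_k$ $(1\le k\le q)$ is a *joint reduction* of $(M_1,\dots,M_q)$ if each $B_k$ can be generated by $r_k$ elements and, for some integer $n\ge 0$, $$\prod_{j=1}^q S_{n+1}(M_j)=\sum_{k=1}^q B_k\,S_n(M_k)\prod_{j\ne k}S_{n+1}(M_j)$$ inside $S(F_1\oplus\cdots\oplus F_q)$. For such $B_k$, let $\det(B_k)\in R$ denote the determinant of an $r_k\times r_k$ matrix whose columns are the coordinates, in a basis of $F_k$, of a system of $r_k$ generators of $B_k$ (it is determined up to a unit), and let $I_k$ be the $0$th Fitting ideal of $F_k/M_k$, i.e. the ideal of $r_k\times r_k$ minors of a matrix whose columns are the coordinates of generators of $M_k$. 1. Suppose $q=d$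 and $M_k\subsetneq F_k$ for all $k$. Then for every joint reduction $(B_1,\dots,B_q)$ of $(M_1,\dots,M_q)$ and every $k$, the element $\det(B_k)$ (for any choice of basis and generators) belongs to a minimal generating set of $I_k$, and every minimal generating set of $B_k$ can be extended to a minimal generating set of $M_k$. 2. Suppose $q\ge d$ and $\operatorname{depth}R>0$. Then there is a joint reduction $(B_1,\dots,B_q)$ of $(M_1,\dots,M_q)$ such that every $B_k$ is a free submodule of $F_k$, of rank $r_k$. -/

import Mathlib

namespace JointReduction

universe u v

/-- `S` is a minimal generating set of the submodule `N`: it generates `N`, and no proper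
subset of `S` does. -/
def IsMinGenSet {R : Type u} {V : Type v} [CommRing R] [AddCommGroup V] [Module R V]
    (N : Submodule R V) (S : Set V) : Prop :=
  Minimal (fun T : Set V => Submodule.span R T = N) S

/-- The depth of a local ring: the supremum of the lengths of the regular sequences contained
in the maximal ideal. -/
noncomputable def depth (R : Type u) [CommRing R] [IsLocalRing R] : ℕ∞ :=
  ⨆ (rs : List R) (_ : ∀ x ∈ rs, x ∈ IsLocalRing.maximalIdeal R)
    (_ : RingTheory.Sequence.IsRegular R rs), (rs.length : ℕ∞)

/-- The submodule `N` of the free module `V` is `r`-generated, where `r` is the rank of `V`. -/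
def IsRankGenerated {R : Type u} {V : Type v} [CommRing R] [AddCommGroup V] [Module R V]
    (N : Submodule R V) : Prop :=
  ∃ b : Fin (Module.finrank R V) → V, Submodule.span R (Set.range b) = N

/-- `x` is a value of `det(N)`: for some basis of the free module `V` of rank `r` and some system
of `r` generators of `N`, the matrix whose columns are the coordinates of the generators has
determinant `x`. -/
def IsDetOf {R : Type u} {V : Type v} [CommRing R] [AddCommGroup V] [Module R V]
    (N : Submodule R V) (x : R) : Prop :=
  ∃ (e : Module.Basis (Fin (Module.finrank R V)) R V) (b : Fin (Module.finrank R V) → V),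
    Submodule.span R (Set.range b) = N ∧ e.det b = x

/-- The ideal `I(N)`, the zeroth Fitting ideal of `V ⧸ N` for a submodule `N` of a free module `V`
of rank `r`, computed from the presentation `N → V → V ⧸ N → 0`: it is generated by the
determinants of all `r × r` matrices whose columns are the coordinates, in a basis of `V`, of
elements of `N`. -/
def fittingIdeal {R : Type u} {V : Type v} [CommRing R] [AddCommGroup V] [Module R V]
    (N : Submodule R V) : Ideal R :=
  Ideal.span {x : R | ∃ (e : Module.Basis (Fin (Module.finrank R V)) R V)
    (m : Fin (Module.finrank R V) → V), (∀ i, m i ∈ N) ∧ e.det m = x}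

section Family

variable {R : Type u} [CommRing R] {q : ℕ} {F : Fin q → Type v}
  [∀ k, AddCommGroup (F k)] [∀ k, Module R (F k)]

/-- For `F = F₁ ⊕ ⋯ ⊕ F_q`, the degree-one piece in the symmetric algebra `S(F)` of a submodule of
the `k`-th summand. -/
noncomputable def symOne (k : Fin q) (N : Submodule R (F k)) :
    Submodule R (SymmetricAlgebra R (∀ j, F j)) :=
  N.map (SymmetricAlgebra.ι R (∀ j, F j) ∘ₗ LinearMap.single R F k)

/-- `S_n(N)` for a submodule `N` of `F_k`: the image in `S(F)` of the `n`-th symmetric power of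
`N`, that is, the span of the `n`-fold products of elements of `N`. -/
noncomputable def symPow (k : Fin q) (N : Submodule R (F k)) (n : ℕ) :
    Submodule R (SymmetricAlgebra R (∀ j, F j)) :=
  symOne k N ^ n

/-- `(B₁, …, B_q)` is a joint reduction of `(M₁, …, M_q)`, where `B_k ⊆ M_k ⊆ F_k` and `F_k` is
free of rank `r_k`: each `B_k` is `r_k`-generated, and for some `n` the product of all the
`S_{n+1}(M_j)` is the sum over `k` of the products in which the factor `S_{n+1}(M_k)` is replaced
by `B_k S_n(M_k)`. -/
def IsJointReduction (M B : ∀ k, Submodule R (F k)) : Prop :=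
  (∀ k, B k ≤ M k) ∧ (∀ k, IsRankGenerated (B k)) ∧
    ∃ n : ℕ, ∏ j, symPow j (M j) (n + 1) =
      ⨆ k, symOne k (B k) * symPow k (M k) n *
        ∏ j ∈ Finset.univ.erase k, symPow j (M j) (n + 1)

end Family

end JointReduction

/-! Valuations give the first assertion. Suppose `q = d` and `det(B_k)` lies in `𝔪 I_k`. The other
`d - 1` determinants lie in a prime `P ≠ 𝔪`; take a valuation ring `O` of `K = Frac(R/P)` dominating
`R/P`. Each `I_j` is nonzero in `K`, because it is not inside `P`, and the image of `det(B_j)` has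
smaller valuation than `I_j`: it is zero for `j ≠ k`, and it lies in `𝔪 I_k` for `j = k`. Cramer's
rule (`exists_functional`) then yields functionals on the `F_j` that are integral on `M_j`, attain a
unit there, and send `B_j` into the maximal ideal of `O`. Together they define an algebra map from
the symmetric algebra to `K`. It sends the left side of the joint reduction equation to a set
containing a unit and the right side into the maximal ideal, which is absurd
(`IsJointReduction.exists_valuation_eq_one`). So `det(B_k)` is not in `𝔪 I_k`, and Nakayama and
Cramer give both conclusions.

For the second, let `U` be the product of the degree-one pieces of the `M_j`, and choose `r_1 + ...
+ r_q` general elements of the `M_k` one at a time. A prime of the Rees algebra `R[Ut]` that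
contains `𝔪` and the chosen elements times their cofactors, but not `Ut`, lies above a chain with
one further prime per choice (`exists_generic`). Such chains have fewer than `d + ∑ (r_k - 1)`
further primes (`not_hasChain`), and this is at most `∑ r_k` when `q ≥ d`. Hence no such prime
exists, `Ut` is nilpotent modulo the chosen elements and `𝔪`, and Nakayama gives the joint reduction
equation. Positive depth lets the choices also keep the determinants outside all associated primes,
so that the `B_k` are free.

The bound on chains is a growth estimate. A chain of `n` primes makes the degree `j` part of a
domain quotient of `R[Ut]` at least as long as the binomial coefficient `(j + n).choose n`. A
valuation ring dominating the localization, and the filtration by powers of one element of `𝔪`,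
bound that length by a constant times `(j + 1) ^ (g + d - 1)`, where `g = ∑ (r_k - 1)`. -/

namespace JointReduction

open IsLocalRing Pointwise

universe u v w

/-! ### Minimal generating sets and Nakayama's lemma. -/

section MinGenSet

variable {R : Type u} {V : Type v} [CommRing R] [IsLocalRing R] [AddCommGroup V] [Module R V]

/-- A set of elements of a finitely generated module over a local ring which is linearly
independent modulo the maximal ideal extends to a minimal generating set. -/
theorem exists_isMinGenSet_of_indep {N : Submodule R V} (hN : N.FG) {S : Set V}
    (hS : S ⊆ N)
    (hind : ∀ (t : Finset V) (g : V → R), ↑t ⊆ S →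
      ∑ i ∈ t, g i • i ∈ maximalIdeal R • N → ∀ i ∈ t, g i ∈ maximalIdeal R) :
    ∃ T : Set V, S ⊆ T ∧ IsMinGenSet N T := by
  classical
  let _ : Field (R ⧸ maximalIdeal R) := Ideal.Quotient.field _
  let J : Submodule R N := maximalIdeal R • (⊤ : Submodule R N)
  have hJ (x : N) : x ∈ J ↔ (x : V) ∈ maximalIdeal R • N := by
    have h : J.map N.subtype = maximalIdeal R • N := by
      rw [Submodule.map_smul'', Submodule.map_top, Submodule.range_subtype]
    rw [← h]
    exact ⟨fun hx => ⟨x, hx, rfl⟩, fun ⟨y, hy, hyx⟩ => by rwa [← Subtype.ext hyx]⟩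
  let π : N → N ⧸ J := J.mkQ
  have hli : LinearIndepOn (R ⧸ maximalIdeal R) π ((↑) ⁻¹' S : Set N) := by
    rw [linearIndepOn_iff']
    intro t g ht h0 i hi
    choose g' hg' using fun j => Ideal.Quotient.mk_surjective (g j)
    have h1 : (∑ j ∈ t, g' j • j : N) ∈ J := by
      rw [← Submodule.Quotient.mk_eq_zero, ← Submodule.mkQ_apply, map_sum, ← h0]
      refine Finset.sum_congr rfl fun j _ => ?_
      rw [← hg', map_smul]
      rfl
    have h2 := hind (t.map (Function.Embedding.subtype _))
      (fun x => if h : x ∈ N then g' ⟨x, h⟩ else 0) (by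
        intro x hx
        obtain ⟨y, hy, rfl⟩ := Finset.mem_map.1 (Finset.mem_coe.1 hx)
        exact ht hy) (by
        rw [Finset.sum_map]
        rw [hJ] at h1
        simpa using h1) i (Finset.mem_map_of_mem _ hi)
    rw [← hg', Ideal.Quotient.eq_zero_iff_mem]
    simpa using h2
  -- The family is indexed by `N` itself, so extending to a basis of `N/𝔪N` directly produces a set
  -- of lifts.
  obtain ⟨b, -, hSb, hspan, hb⟩ := exists_linearIndepOn_extension hli (Set.subset_univ _)
  have hgen : Submodule.span R ((↑) '' b : Set V) = N := by
    apply le_antisymm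
    · rw [Submodule.span_le]
      rintro _ ⟨y, -, rfl⟩
      exact y.2
    · refine Submodule.le_of_le_smul_of_le_jacobson_bot hN (maximalIdeal_le_jacobson _) ?_
      intro x hx
      have h3 := hspan ⟨⟨x, hx⟩, trivial, rfl⟩
      have h3 : J.mkQ ⟨x, hx⟩ ∈ (Submodule.span R b).map J.mkQ := by
        rw [Submodule.map_span]
        rw [← Submodule.coe_restrictScalars (S := R), SetLike.mem_coe,
          Submodule.restrictScalars_span R _ Ideal.Quotient.mk_surjective] at h3
        exact h3
      obtain ⟨y, hy, hyx⟩ := h3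
      have h4 : (⟨x, hx⟩ - y : N) ∈ J := by
        rw [← Submodule.Quotient.mk_eq_zero, ← Submodule.mkQ_apply, map_sub, hyx, sub_self]
      rw [hJ] at h4
      have h5 : (y : V) ∈ Submodule.span R ((↑) '' b : Set V) := by
        have := Submodule.mem_map_of_mem (f := N.subtype) hy
        rwa [Submodule.map_span] at this
      have := Submodule.add_mem_sup h5 h4
      simpa using this
  refine ⟨(↑) '' b, fun x hx => ⟨⟨x, hS hx⟩, hSb hx, rfl⟩, hgen, ?_⟩
  rintro T hT hTb _ ⟨x, hx, rfl⟩
  by_contra hxT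
  have hxs : (x : V) ∈ Submodule.span R T := by rw [hT]; exact x.2
  have hTsub : T ⊆ (↑) '' (b \ {x}) := by
    intro y hy
    obtain ⟨z, hz, rfl⟩ := hTb hy
    exact ⟨z, ⟨hz, fun hzx => hxT (by rwa [← Set.mem_singleton_iff.1 hzx])⟩, rfl⟩
  have h6 : x ∈ Submodule.span R (b \ {x}) := by
    have := Submodule.span_mono (R := R) hTsub hxs
    change (x : V) ∈ Submodule.span R (N.subtype '' (b \ {x})) at this
    rw [← Submodule.map_span] at this
    obtain ⟨y, hy, hyx⟩ := this
    have hyx' : y = x := Subtype.ext hyx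
    exact hyx' ▸ hy
  have h7 : π x ∈ Submodule.span (R ⧸ maximalIdeal R) (π '' (b \ {x})) := by
    have := Submodule.mem_map_of_mem (f := J.mkQ) h6
    rw [Submodule.map_span] at this
    exact Submodule.span_le_restrictScalars R (R ⧸ maximalIdeal R) _ this
  refine LinearIndepOn.notMem_span_of_insert (i := x) (s := b \ {x}) ?_ (by simp) h7
  rwa [Set.insert_sdiff_singleton, Set.insert_eq_of_mem hx]

/-- If `b` is linearly independent modulo `𝔪 N`, then any minimal generating set of its span
extends to a minimal generating set of `N`. -/
theorem exists_isMinGenSet_of_span_indep {N : Submodule R V} (hN : N.FG) {ι : Type w} [Fintype ι]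
    {b : ι → V} (hbN : ∀ i, b i ∈ N)
    (hb : ∀ c : ι → R, ∑ i, c i • b i ∈ maximalIdeal R • N → ∀ i, c i ∈ maximalIdeal R)
    {S : Set V} (hS : IsMinGenSet (Submodule.span R (Set.range b)) S) :
    ∃ T : Set V, S ⊆ T ∧ IsMinGenSet N T := by
  classical
  set B := Submodule.span R (Set.range b) with hB
  have hBN : B ≤ N := by
    rw [hB, Submodule.span_le]
    rintro _ ⟨i, rfl⟩
    exact hbN i
  have hSB : S ⊆ B := by
    have h := Submodule.subset_span (R := R) (s := S)
    rwa [hS.prop] at h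
  -- Independence of `b` makes `B ∩ 𝔪N` equal to `𝔪B`. A relation among elements of `S` modulo `𝔪N`
  -- thus holds modulo `𝔪B`, where a unit coefficient would make an element of `S` redundant.
  have hmB : ∀ x ∈ B, x ∈ maximalIdeal R • N → x ∈ maximalIdeal R • B := by
    intro x hx hxm
    obtain ⟨c, rfl⟩ := (Submodule.mem_span_range_iff_exists_fun R).1 hx
    exact Submodule.sum_mem _ fun i _ =>
      Submodule.smul_mem_smul (hb c hxm i) (Submodule.subset_span ⟨i, rfl⟩)
  refine exists_isMinGenSet_of_indep hN (fun x hx => hBN (hSB hx)) fun t g ht h0 i hi => ?_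
  by_contra hgi
  have hu : IsUnit (g i) := by simpa using hgi
  have h1 := hmB _ (Submodule.sum_mem _ fun j hj => Submodule.smul_mem _ _ (hSB (ht hj))) h0
  have hle : B ≤ Submodule.span R (S \ {i}) := by
    refine Submodule.le_of_le_smul_of_le_jacobson_bot (Submodule.fg_span (Set.finite_range b))
      (maximalIdeal_le_jacobson _) ?_
    nth_rw 1 [← hS.prop]
    rw [Submodule.span_le]
    intro y hy
    by_cases hyi : y = i
    · subst hyi
      rw [← Finset.add_sum_erase _ _ hi] at h1
      have h2 : ∑ j ∈ t.erase y, g j • j ∈ Submodule.span R (S \ {y}) :=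
        Submodule.sum_mem _ fun j hj => Submodule.smul_mem _ _ (Submodule.subset_span
          ⟨ht (Finset.mem_of_mem_erase hj), Finset.ne_of_mem_erase hj⟩)
      have h3 : g y • y ∈ Submodule.span R (S \ {y}) ⊔ maximalIdeal R • B := by
        have := Submodule.add_mem_sup (neg_mem h2) h1
        simpa using this
      obtain ⟨u, hu⟩ := hu
      rw [← hu] at h3
      simpa using Submodule.smul_mem _ (↑u⁻¹ : R) h3
    · exact Submodule.mem_sup_left (Submodule.subset_span ⟨hy, hyi⟩)
  have hspan : Submodule.span R (S \ {i}) = B :=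
    le_antisymm (hS.prop ▸ Submodule.span_mono Set.sdiff_subset) hle
  exact (hS.le_of_le hspan Set.sdiff_subset (ht hi)).2 rfl

/-- An element of `N` outside `𝔪 N` belongs to a minimal generating set of `N`. -/
theorem exists_isMinGenSet_of_notMem {N : Submodule R V} (hN : N.FG) {x : V} (hx : x ∈ N)
    (hxm : x ∉ maximalIdeal R • N) : ∃ T : Set V, x ∈ T ∧ IsMinGenSet N T := by
  classical
  obtain ⟨T, hT, h⟩ := exists_isMinGenSet_of_indep hN (S := {x}) (by simpa using hx)
    fun t g ht h0 i hi => by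
      have hix : i = x := by simpa using ht hi
      subst hix
      by_contra hgi
      have hu : IsUnit (g i) := by simpa using hgi
      have ht' : t = {i} := by
        ext j
        refine ⟨fun hj => by simpa using ht hj, fun hj => ?_⟩
        rwa [Finset.mem_singleton.1 hj]
      rw [ht', Finset.sum_singleton] at h0
      obtain ⟨u, hu⟩ := hu
      rw [← hu] at h0
      exact hxm (by simpa using Submodule.smul_mem _ (↑u⁻¹ : R) h0)
  exact ⟨T, hT rfl, h⟩

end MinGenSet

/-! ### Determinants, Fitting ideals and Cramer's rule. -/

section Det

variable {R : Type u} {V : Type v} [CommRing R] [AddCommGroup V] [Module R V]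

theorem det_mem_fittingIdeal {N : Submodule R V}
    (e : Module.Basis (Fin (Module.finrank R V)) R V) {m : Fin (Module.finrank R V) → V}
    (hm : ∀ i, m i ∈ N) : e.det m ∈ fittingIdeal N :=
  Submodule.subset_span ⟨e, m, hm, rfl⟩

/-- The Fitting ideal may be computed in any fixed basis. -/
theorem fittingIdeal_eq_span (N : Submodule R V)
    (e : Module.Basis (Fin (Module.finrank R V)) R V) :
    fittingIdeal N = Ideal.span {x : R | ∃ m : Fin (Module.finrank R V) → V,
      (∀ i, m i ∈ N) ∧ e.det m = x} := by
  apply le_antisymm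
  · refine Ideal.span_le.2 ?_
    rintro _ ⟨e', m, hm, rfl⟩
    rw [e'.det.eq_smul_basis_det e]
    exact Ideal.mul_mem_left _ _ (Ideal.subset_span ⟨m, hm, rfl⟩)
  · refine Ideal.span_mono ?_
    rintro _ ⟨m, hm, rfl⟩
    exact ⟨e, m, hm, rfl⟩

/-- The determinant as a linear function of its `j`-th argument. -/
noncomputable def detAt {ι : Type w} [Fintype ι] [DecidableEq ι] (e : Module.Basis ι R V)
    (m : ι → V) (j : ι) : V →ₗ[R] R :=
  e.det.toMultilinearMap.toLinearMap m j

theorem detAt_apply {ι : Type w} [Fintype ι] [DecidableEq ι] (e : Module.Basis ι R V)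
    (m : ι → V) (j : ι) (x : V) : detAt e m j x = e.det (Function.update m j x) := rfl

theorem detAt_self {ι : Type w} [Fintype ι] [DecidableEq ι] (e : Module.Basis ι R V)
    (m : ι → V) (i j : ι) : detAt e m j (m i) = if i = j then e.det m else 0 := by
  rw [detAt_apply]
  split_ifs with h
  · rw [h, Function.update_eq_self]
  · exact e.det.map_update_self m (Ne.symm h)

theorem detAt_sum {ι : Type w} [Fintype ι] [DecidableEq ι] (e : Module.Basis ι R V)
    (m : ι → V) (j : ι) (c : ι → R) : detAt e m j (∑ i, c i • m i) = c j * e.det m := by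
  simp [map_sum, detAt_self]

/-- Linearity in one argument: with the other arguments in `N`, the determinant carries `N` into the
Fitting ideal, hence `J • N` into `J` times it. -/
theorem detAt_mem_smul {N : Submodule R V} {J : Ideal R}
    (e : Module.Basis (Fin (Module.finrank R V)) R V) {m : Fin (Module.finrank R V) → V}
    (hm : ∀ i, m i ∈ N) (j : Fin (Module.finrank R V)) {x : V} (hx : x ∈ J • N) :
    detAt e m j x ∈ J • fittingIdeal N := by
  have h1 : N.map (detAt e m j) ≤ fittingIdeal N := by
    rintro _ ⟨y, hy, rfl⟩
    refine det_mem_fittingIdeal e fun i => ?_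
    by_cases h : i = j
    · subst h; simpa using hy
    · simpa [h] using hm i
  have h2 : detAt e m j x ∈ (J • N).map (detAt e m j) := ⟨x, hx, rfl⟩
  rw [Submodule.map_smul''] at h2
  exact smul_mono_right _ h1 h2

/-- Inserting the relation into the `j`-th slot of the determinant leaves `c j * e.det b`, an
element of `𝔪` times the Fitting ideal; a unit `c j` would put the determinant there too. -/
theorem mem_maximalIdeal_of_det_notMem [IsLocalRing R] {N : Submodule R V}
    (e : Module.Basis (Fin (Module.finrank R V)) R V) {b : Fin (Module.finrank R V) → V}
    (hb : ∀ i, b i ∈ N) (hdet : e.det b ∉ maximalIdeal R • fittingIdeal N)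
    (c : Fin (Module.finrank R V) → R) (hc : ∑ i, c i • b i ∈ maximalIdeal R • N)
    (j : Fin (Module.finrank R V)) : c j ∈ maximalIdeal R := by
  by_contra hcj
  have hu : IsUnit (c j) := by simpa using hcj
  have h := detAt_mem_smul e hb j hc
  rw [detAt_sum] at h
  obtain ⟨u, hu⟩ := hu
  rw [← hu] at h
  exact hdet (by simpa using Ideal.mul_mem_left _ (↑u⁻¹ : R) h)

end Det

/-! ### Functionals with values in a valuation ring. -/

section Functional

variable {R : Type u} {V : Type v} [CommRing R] [AddCommGroup V] [Module R V]
variable {K : Type w} [Field K] [Algebra R K] (O : ValuationSubring K)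

/-- Over a valuation ring a matrix whose determinant is not a unit has a nontrivial left kernel
modulo the maximal ideal. -/
theorem exists_primitive_vecMul {n : Type*} [Fintype n] [DecidableEq n]
    (C : Matrix n n K) (hC : ∀ i j, O.valuation (C i j) ≤ 1) (hdet : O.valuation C.det < 1) :
    ∃ l : n → K, (∀ i, O.valuation (l i) ≤ 1) ∧ (∃ i, O.valuation (l i) = 1) ∧
      ∀ j, O.valuation (Matrix.vecMul l C j) < 1 := by
  let C' : Matrix n n O := fun i j => ⟨C i j, (O.valuation_le_one_iff _).1 (hC i j)⟩
  have hCC' : C = C'.map O.subtype := rfl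
  have h1 : C'.det ∈ maximalIdeal O := by
    rw [ValuationSubring.valuation_lt_one_iff]
    convert hdet
    rw [hCC', ← RingHom.mapMatrix_apply, ← RingHom.map_det]
    rfl
  have h2 : (C'.map (residue O)).det = 0 := by
    rw [← RingHom.mapMatrix_apply, ← RingHom.map_det]
    exact Ideal.Quotient.eq_zero_iff_mem.2 h1
  obtain ⟨l, hl0, hl⟩ := Matrix.exists_vecMul_eq_zero_iff.2 h2
  choose l' hl' using fun i => residue_surjective (l i)
  obtain ⟨i, hi⟩ := Function.ne_iff.1 hl0
  refine ⟨fun i => l' i, fun i => O.valuation_le_one _, ⟨i, ?_⟩, fun j => ?_⟩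
  · rw [← ValuationSubring.valuation_eq_one_iff]
    by_contra hu
    exact hi (by rw [← hl', Pi.zero_apply, residue_eq_zero_iff]; exact hu)
  · have h3 : residue O (Matrix.vecMul l' C' j) = 0 := by
      have := congrFun hl j
      rw [← funext hl'] at this
      rw [RingHom.map_vecMul]
      exact this
    rw [residue_eq_zero_iff, ValuationSubring.valuation_lt_one_iff] at h3
    convert h3
    rw [hCC']
    exact (RingHom.map_vecMul O.subtype C' l' j).symm

/-- The functional criterion: if the determinant of `b` has smaller valuation than the Fitting
ideal of `N`, there is a functional which is a surjection from `N` to the valuation ring after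
extension of scalars and maps `b` to the maximal ideal. -/
theorem exists_functional {N : Submodule R V} (hI : (fittingIdeal N).FG)
    (hR : ∀ r : R, algebraMap R K r ∈ O)
    (e : Module.Basis (Fin (Module.finrank R V)) R V) {b : Fin (Module.finrank R V) → V}
    (hb : ∀ i, b i ∈ N) (hI0 : ∃ x ∈ fittingIdeal N, algebraMap R K x ≠ 0)
    (hdet : algebraMap R K (e.det b) = 0 ∨
      ∃ J : Ideal R, (∀ x ∈ J, O.valuation (algebraMap R K x) < 1) ∧
        e.det b ∈ J • fittingIdeal N) :
    ∃ l : V →ₗ[R] K, (∀ x ∈ N, O.valuation (l x) ≤ 1) ∧ (∃ x ∈ N, O.valuation (l x) = 1) ∧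
      ∀ i, O.valuation (l (b i)) < 1 := by
  classical
  have hR' : ∀ r : R, O.valuation (algebraMap R K r) ≤ 1 := fun r =>
    (O.valuation_le_one_iff _).2 (hR r)
  set v := O.valuation with hv
  -- a tuple whose determinant has maximal valuation
  obtain ⟨m, hmN, hm⟩ : ∃ m : Fin (Module.finrank R V) → V, (∀ i, m i ∈ N) ∧
      ∀ x ∈ fittingIdeal N, v (algebraMap R K x) ≤ v (algebraMap R K (e.det m)) := by
    have hI' := hI
    rw [fittingIdeal_eq_span N e] at hI'
    obtain ⟨s, hs, hspan⟩ := (Submodule.fg_span_iff_fg_span_finset_subset _).1 hI'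
    have hne : s.Nonempty := by
      rw [Finset.nonempty_iff_ne_empty]
      rintro rfl
      obtain ⟨x, hx, hx0⟩ := hI0
      rw [fittingIdeal_eq_span N e] at hx
      change x ∈ Submodule.span R _ at hx
      rw [hspan] at hx
      simp at hx
      exact hx0 (by rw [hx, map_zero])
    obtain ⟨y, hy, hmax⟩ := s.exists_max_image (fun y => v (algebraMap R K y)) hne
    obtain ⟨m, hmN, rfl⟩ := hs hy
    refine ⟨m, hmN, fun x hx => ?_⟩
    rw [fittingIdeal_eq_span N e] at hx
    change x ∈ Submodule.span R _ at hx
    rw [hspan] at hx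
    induction hx using Submodule.span_induction with
    | mem x hx => exact hmax x hx
    | zero => simp
    | add x y _ _ hx hy => rw [map_add]; exact (v.map_add _ _).trans (max_le hx hy)
    | smul r x _ hx =>
      rw [smul_eq_mul, map_mul, map_mul]
      exact (mul_le_mul' (hR' r) hx).trans (one_mul _).le
  set D := algebraMap R K (e.det m) with hD
  have hD0 : D ≠ 0 := by
    intro h
    obtain ⟨x, hx, hx0⟩ := hI0
    have := hm x hx
    rw [h, map_zero, le_zero_iff, Valuation.zero_iff] at this
    exact hx0 this
  have hvD : v D ≠ 0 := by rwa [Ne, Valuation.zero_iff]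
  -- the coordinate functionals
  let c : Fin (Module.finrank R V) → V →ₗ[R] K := fun i =>
    (LinearMap.mulRight R D⁻¹) ∘ₗ (Algebra.linearMap R K) ∘ₗ detAt e m i
  have hc (i) (x : V) : c i x = algebraMap R K (detAt e m i x) * D⁻¹ := rfl
  have hcm (i j) : c i (m j) = if j = i then 1 else 0 := by
    rw [hc, detAt_self]
    split_ifs
    · exact mul_inv_cancel₀ hD0
    · simp
  have hcN (i) (x : V) (hx : x ∈ N) : v (c i x) ≤ 1 := by
    rw [hc, map_mul, map_inv₀]
    refine mul_inv_le_of_le_mul₀ zero_le zero_le ?_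
    rw [one_mul]
    refine hm _ (det_mem_fittingIdeal e fun k => ?_)
    by_cases h : k = i
    · subst h; simpa using hx
    · simpa [h] using hmN k
  -- Both sides are alternating forms in `y`, hence proportional; the constant is found at `y = m`,
  -- where the matrix is the identity.
  have hcdet (y : Fin (Module.finrank R V) → V) :
      Matrix.det (Matrix.of fun i j => c i (y j)) = algebraMap R K (e.det y) * D⁻¹ := by
    let f : V [⋀^Fin (Module.finrank R V)]→ₗ[R] K :=
      (Algebra.linearMap R K).compAlternatingMap e.det
    let g : V [⋀^Fin (Module.finrank R V)]→ₗ[R] K :=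
      { ((Matrix.detRowAlternating (R := K)
          (n := Fin (Module.finrank R V))).toMultilinearMap.restrictScalars R).compLinearMap
            (fun _ => LinearMap.pi c) with
        map_eq_zero_of_eq' := fun y i j hij hne =>
          Matrix.det_zero_of_row_eq (M := fun k => LinearMap.pi c (y k)) hne (by rw [hij]) }
    have hg (y) : g y = Matrix.det (Matrix.of fun i j => c i (y j)) := by
      rw [← Matrix.det_transpose]; rfl
    have hfg (y) : g y = g e * f y := by
      have : g = (LinearMap.mulLeft R (g e)).compAlternatingMap f := by
        refine e.ext_alternating fun σ hσ => ?_
        let τ : Equiv.Perm (Fin (Module.finrank R V)) :=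
          Equiv.ofBijective σ (Finite.injective_iff_bijective.1 hσ)
        have h1 := g.map_perm e τ
        have h2 := f.map_perm e τ
        have h3 : (fun i => e (σ i)) = e ∘ τ := rfl
        have h4 : f e = 1 := by simp [f, e.det_self]
        rw [h3, LinearMap.compAlternatingMap_apply, h1, h2, h4]
        simp
      rw [this]
      simp [f, e.det_self]
    have h5 : g e * D = 1 := by
      have := hfg m
      rw [hg] at this
      rw [show D = f m from rfl, ← this]
      have h6 : (Matrix.of fun i j => c i (m j)) = 1 := by
        ext i j
        rw [Matrix.of_apply, hcm, Matrix.one_apply]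
        simp [eq_comm]
      rw [h6, Matrix.det_one]
    rw [← hg, hfg, eq_inv_of_mul_eq_one_left h5, mul_comm]
    rfl
  -- The matrix of coordinates of `b` has determinant `det b / D` of valuation below one, so it is
  -- singular over the residue field.
  obtain ⟨l, hl1, ⟨i, hi⟩, hlC⟩ := exists_primitive_vecMul O (Matrix.of fun i j => c i (b j))
    (fun i j => hcN i _ (hb j)) (by
      rw [hcdet, map_mul, map_inv₀]
      refine mul_inv_lt_of_lt_mul₀ ?_
      rw [one_mul]
      rcases hdet with h | ⟨J, hJ, h⟩
      · rw [h, map_zero]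
        exact zero_lt_iff.2 hvD
      · refine Submodule.smul_induction_on h (fun r hr x hx => ?_) fun x y hx hy => ?_
        · rw [smul_eq_mul, map_mul, map_mul]
          calc _ ≤ v (algebraMap R K r) * v D := mul_le_mul_right (hm x hx) _
            _ < v D := mul_lt_of_lt_one_left (zero_lt_iff.2 hvD) (hJ r hr)
        · rw [map_add]
          exact v.map_add_lt hx hy)
  refine ⟨∑ i, (LinearMap.mulLeft R (l i)) ∘ₗ c i, fun x hx => ?_, ⟨m i, hmN i, ?_⟩, fun j => ?_⟩
  · rw [LinearMap.sum_apply]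
    refine v.map_sum_le fun i _ => ?_
    rw [LinearMap.comp_apply, LinearMap.mulLeft_apply, map_mul]
    exact mul_le_one' (hl1 i) (hcN i x hx)
  · rw [LinearMap.sum_apply]
    simpa [hcm] using hi
  · have := hlC j
    rw [LinearMap.sum_apply]
    exact this

end Functional

theorem prod_mem_prod_submodule {R : Type u} {A : Type v} [CommSemiring R] [CommSemiring A]
    [Algebra R A] {ι : Type w} {s : Finset ι} {N : ι → Submodule R A} {x : ι → A}
    (h : ∀ i ∈ s, x i ∈ N i) :
    ∏ i ∈ s, x i ∈ (∏ i ∈ s, N i : Submodule R A) := by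
  classical
  induction s using Finset.induction_on with
  | empty => exact Submodule.one_le.1 le_rfl
  | insert a s ha ih =>
    rw [Finset.prod_insert ha, Finset.prod_insert ha]
    exact Submodule.mul_mem_mul (h _ (Finset.mem_insert_self _ _))
      (ih fun i hi => h i (Finset.mem_insert_of_mem hi))

/-! ### Testing joint reductions by valuations. -/

section Family

variable {R : Type u} [CommRing R] {q : ℕ} {F : Fin q → Type v}
  [∀ k, AddCommGroup (F k)] [∀ k, Module R (F k)]

/-- Functionals on the `F k` which are surjective on the `M k` over a valuation ring cannot map
all the members of a joint reduction into the maximal ideal. -/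
theorem IsJointReduction.exists_valuation_eq_one {M B : ∀ k, Submodule R (F k)}
    (h : IsJointReduction M B) {K : Type w} [Field K] [Algebra R K] (O : ValuationSubring K)
    (hR : ∀ r : R, algebraMap R K r ∈ O) (l : ∀ k, F k →ₗ[R] K)
    (hl : ∀ k, ∀ x ∈ M k, O.valuation (l k x) ≤ 1)
    (hl1 : ∀ k, ∃ x ∈ M k, O.valuation (l k x) = 1) :
    ∃ k, ∃ x ∈ B k, ¬ O.valuation (l k x) < 1 := by
  by_contra! hB
  obtain ⟨-, -, n, hn⟩ := h
  let A : Subalgebra R K :=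
    { O.toSubring with
      algebraMap_mem' := hR }
  let J : Submodule R K :=
    { carrier := {x | O.valuation x < 1}
      add_mem' := fun {a b} ha hb => O.valuation.map_add_lt ha hb
      zero_mem' := by simp
      smul_mem' := fun r x hx => by
        change O.valuation (r • x) < 1
        rw [Algebra.smul_def, map_mul]
        exact (mul_le_of_le_one_left' ((O.valuation_le_one_iff _).2 (hR r))).trans_lt hx }
  have hA (x : K) : x ∈ A ↔ O.valuation x ≤ 1 := (O.valuation_le_one_iff x).symm
  have hJA : J * A.toSubmodule ≤ J := by
    rw [Submodule.mul_le]
    intro x hx y hy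
    change O.valuation (x * y) < 1
    rw [map_mul]
    exact (mul_le_of_le_one_right' ((hA y).1 hy)).trans_lt hx
  -- The functionals assemble into one algebra map, which is applied to both sides of the joint
  -- reduction equation.
  let Φ : SymmetricAlgebra R (∀ j, F j) →ₐ[R] K :=
    SymmetricAlgebra.lift (∑ k, l k ∘ₗ LinearMap.proj k)
  have hΦ (k) (x : F k) :
      Φ (SymmetricAlgebra.ι R (∀ j, F j) (LinearMap.single R F k x)) = l k x := by
    rw [SymmetricAlgebra.lift_ι_apply, LinearMap.sum_apply,
      Finset.sum_eq_single_of_mem k (Finset.mem_univ _)]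
    · simp
    · intro j _ hj
      simp [hj]
  have hmapM (k) : (symOne k (M k)).map Φ.toLinearMap ≤ A.toSubmodule := by
    rw [symOne, ← Submodule.map_comp, Submodule.map_le_iff_le_comap]
    intro x hx
    exact (hA _).2 ((congrArg O.valuation (hΦ k x)).trans_le (hl k x hx))
  have hmapB (k) : (symOne k (B k)).map Φ.toLinearMap ≤ J := by
    rw [symOne, ← Submodule.map_comp, Submodule.map_le_iff_le_comap]
    intro x hx
    exact (congrArg O.valuation (hΦ k x)).trans_lt (hB k x hx)
  have hpow (N : Submodule R K) (hN : N ≤ A.toSubmodule) (i : ℕ) : N ^ i ≤ A.toSubmodule := by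
    intro x hx
    induction hx using Submodule.pow_induction_on_left' with
    | algebraMap r => exact A.algebraMap_mem r
    | add x y i _ _ hx hy => exact A.add_mem hx hy
    | mem_mul x hx i y _ hy => exact A.mul_mem (hN hx) hy
  have hsymPow (k) (i : ℕ) : (symPow k (M k) i).map Φ.toLinearMap ≤ A.toSubmodule := by
    rw [symPow, Submodule.map_pow]
    exact hpow _ (hmapM k) i
  have hmapprod (s : Finset (Fin q)) :
      (∏ j ∈ s, symPow j (M j) (n + 1)).map Φ.toLinearMap ≤ A.toSubmodule := by
    classical
    induction s using Finset.induction_on with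
    | empty =>
      rw [Finset.prod_empty, Submodule.map_one]
      exact Submodule.one_le.2 A.one_mem
    | insert a s ha ih =>
      rw [Finset.prod_insert ha, Submodule.map_mul, Submodule.mul_le]
      exact fun x hx y hy => A.mul_mem (hsymPow a _ hx) (ih hy)
  have hRHS : (∏ j, symPow j (M j) (n + 1)).map Φ.toLinearMap ≤ J := by
    rw [hn, Submodule.map_iSup]
    refine iSup_le fun k => ?_
    rw [Submodule.map_mul, Submodule.map_mul]
    exact (mul_le_mul' ((mul_le_mul' (hmapB k) (hsymPow k n)).trans hJA) (hmapprod _)).trans hJA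
  choose x hx hx1 using hl1
  have hmem : ∏ j, (SymmetricAlgebra.ι R (∀ j, F j) (LinearMap.single R F j (x j))) ^ (n + 1) ∈
      ∏ j, symPow j (M j) (n + 1) :=
    prod_mem_prod_submodule fun j _ => Submodule.pow_mem_pow _ (Submodule.mem_map_of_mem (hx j)) _
  have := hRHS ⟨_, hmem, rfl⟩
  change O.valuation (Φ _) < 1 at this
  simp only [map_prod, map_pow, hΦ, hx1, one_pow, Finset.prod_const_one, lt_self_iff_false] at this

end Family

/-! ### Determinants of joint reductions when `q` is the dimension. -/

section Local

variable {R : Type u} [CommRing R] [IsLocalRing R]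

/-- A submodule of finite colength contains `𝔪 ^ c F`. -/
theorem exists_pow_smul_top_le {V : Type v} [AddCommGroup V] [Module R V] {N : Submodule R V}
    (h : IsFiniteLength R (V ⧸ N)) :
    ∃ c : ℕ, maximalIdeal R ^ c • (⊤ : Submodule R V) ≤ N := by
  obtain ⟨h1, h2⟩ := isFiniteLength_iff_isNoetherian_isArtinian.1 h
  let f : ℕ →o (Submodule R (V ⧸ N))ᵒᵈ :=
    { toFun := fun i => OrderDual.toDual (maximalIdeal R ^ i • ⊤)
      monotone' := fun i j hij => Submodule.smul_mono_left (Ideal.pow_le_pow_right hij) }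
  obtain ⟨c, hc⟩ := IsArtinian.monotone_stabilizes f
  have h3 : maximalIdeal R ^ c • (⊤ : Submodule R (V ⧸ N)) =
      maximalIdeal R • maximalIdeal R ^ c • ⊤ := by
    rw [← mul_smul, ← pow_succ']
    exact hc (c + 1) (Nat.le_succ c)
  have h4 : maximalIdeal R ^ c • (⊤ : Submodule R (V ⧸ N)) ≤ ⊥ :=
    Submodule.le_of_le_smul_of_le_jacobson_bot (IsNoetherian.noetherian _)
      (maximalIdeal_le_jacobson _) (by rw [bot_sup_eq]; exact h3.le)
  refine ⟨c, ?_⟩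
  rw [← Submodule.ker_mkQ N, LinearMap.ker, ← Submodule.map_le_iff_le_comap, Submodule.map_smul'']
  exact (smul_mono_right _ le_top).trans h4

/-- Krull's height theorem: a minimal prime over fewer than `d` elements has height less than `d`.
-/
theorem exists_prime_ne_maximalIdeal [IsNoetherianRing R] {d : ℕ} (hd : ringKrullDim R = d)
    (s : Finset R) (hs : s.card < d) (hsm : ∀ x ∈ s, x ∈ maximalIdeal R) :
    ∃ P : Ideal R, P.IsPrime ∧ P ≠ maximalIdeal R ∧ ∀ x ∈ s, x ∈ P := by
  obtain ⟨P, hP, -⟩ := Ideal.exists_minimalPrimes_le (I := Ideal.span (s : Set R))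
    (J := maximalIdeal R) (Ideal.span_le.2 hsm)
  refine ⟨P, hP.1.1, ?_, fun x hx => hP.1.2 (Ideal.subset_span hx)⟩
  rintro rfl
  have h1 := Ideal.height_le_card_of_mem_minimalPrimes_span_finset hP
  have h2 := maximalIdeal_height_eq_ringKrullDim (R := R)
  rw [hd] at h2
  have h3 : (maximalIdeal R).height = d := by exact_mod_cast h2
  rw [h3] at h1
  exact absurd (by exact_mod_cast h1) (not_le.2 hs)

theorem det_mem_maximalIdeal {V : Type v} [AddCommGroup V] [Module R V]
    {N : Submodule R V} (hN : N ≠ ⊤) (e : Module.Basis (Fin (Module.finrank R V)) R V)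
    {b : Fin (Module.finrank R V) → V} (hb : ∀ i, b i ∈ N) : e.det b ∈ maximalIdeal R := by
  by_contra h
  have hu : IsUnit (e.det b) := by simpa using h
  obtain ⟨-, h2⟩ := (Module.Basis.is_basis_iff_det e).2 hu
  apply hN
  rw [eq_top_iff, ← h2, Submodule.span_le]
  rintro _ ⟨i, rfl⟩
  exact hb i

/-- For `a` in `𝔪` outside `P`, the vectors `a ^ c • e i` lie in `N` and their determinant is a
power of `a`. -/
theorem fittingIdeal_not_le {V : Type v} [AddCommGroup V] [Module R V]
    {N : Submodule R V} {c : ℕ} (hc : maximalIdeal R ^ c • (⊤ : Submodule R V) ≤ N)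
    (e : Module.Basis (Fin (Module.finrank R V)) R V)
    {P : Ideal R} [P.IsPrime] (hP : P ≠ maximalIdeal R) : ∃ x ∈ fittingIdeal N, x ∉ P := by
  obtain ⟨a, ha, haP⟩ := SetLike.not_le_iff_exists.1
    fun h => hP (le_antisymm (le_maximalIdeal (Ideal.IsPrime.ne_top ‹_›)) h)
  refine ⟨_, det_mem_fittingIdeal e (m := fun i => a ^ c • e i) fun i =>
    hc (Submodule.smul_mem_smul (Ideal.pow_mem_pow ha c) trivial), ?_⟩
  rw [AlternatingMap.map_smul_univ, e.det_self]
  simp only [Finset.prod_const, smul_eq_mul, mul_one]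
  intro h
  exact haP (Ideal.IsPrime.mem_of_pow_mem ‹_› _ (Ideal.IsPrime.mem_of_pow_mem ‹_› _ h))

/-- The determinants of a joint reduction of as many modules as the dimension are not in the
products of the Fitting ideals with the maximal ideal. -/
theorem IsJointReduction.det_notMem [IsNoetherianRing R] {q : ℕ} {F : Fin q → Type v}
    [∀ k, AddCommGroup (F k)] [∀ k, Module R (F k)]
    [∀ k, Module.Free R (F k)] [∀ k, Module.Finite R (F k)]
    {M B : ∀ k, Submodule R (F k)} (h : IsJointReduction M B)
    (hd : ringKrullDim R = q) (hM : ∀ k, IsFiniteLength R (F k ⧸ M k)) (hM' : ∀ k, M k ≠ ⊤)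
    (k : Fin q) (e : Module.Basis (Fin (Module.finrank R (F k))) R (F k))
    {b : Fin (Module.finrank R (F k)) → F k} (hb : Submodule.span R (Set.range b) = B k) :
    e.det b ∉ maximalIdeal R • fittingIdeal (M k) := by
  classical
  intro hmem
  choose b' hb' using h.2.1
  let e' (j) := Module.finBasis R (F j)
  have hspan {j : Fin q} {y : Fin (Module.finrank R (F j)) → F j}
      (hy : Submodule.span R (Set.range y) = B j) (i) : y i ∈ M j :=
    h.1 j (hy ▸ Submodule.subset_span ⟨i, rfl⟩)
  obtain ⟨P, hPp, hPm, hP⟩ := exists_prime_ne_maximalIdeal hd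
    ((Finset.univ.erase k).image fun j => (e' j).det (b' j))
    (Finset.card_image_le.trans_lt (by
      rw [Finset.card_erase_of_mem (Finset.mem_univ _), Finset.card_univ, Fintype.card_fin]
      exact Nat.sub_lt (Nat.pos_of_ne_zero fun h => by subst h; exact k.elim0) one_pos)) (by
      intro x hx
      obtain ⟨j, -, rfl⟩ := Finset.mem_image.1 hx
      exact det_mem_maximalIdeal (hM' j) _ (hspan (hb' j)))
  let K := FractionRing (R ⧸ P)
  have hker (x : R) : algebraMap R K x = 0 ↔ x ∈ P := by
    rw [IsScalarTower.algebraMap_apply R (R ⧸ P) K,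
      map_eq_zero_iff _ (IsFractionRing.injective (R ⧸ P) K)]
    exact Ideal.Quotient.eq_zero_iff_mem
  obtain ⟨O, hO, hloc⟩ := exists_factor_valuationRing (algebraMap R K)
  have hval : ∀ x ∈ maximalIdeal R, O.valuation (algebraMap R K x) < 1 := by
    intro x hx
    have := (ValuationSubring.valuation_lt_one_iff O ⟨algebraMap R K x, hO x⟩).1
      (fun hu => hx (hloc.map_nonunit x hu))
    exact this
  have hI0 (j) : ∃ x ∈ fittingIdeal (M j), algebraMap R K x ≠ 0 := by
    obtain ⟨c, hc⟩ := exists_pow_smul_top_le (hM j)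
    obtain ⟨x, hx, hxP⟩ := fittingIdeal_not_le hc (e' j) hPm
    exact ⟨x, hx, fun h => hxP ((hker x).1 h)⟩
  have hfun (j) : ∃ l : F j →ₗ[R] K, (∀ x ∈ M j, O.valuation (l x) ≤ 1) ∧
      (∃ x ∈ M j, O.valuation (l x) = 1) ∧ ∀ x ∈ B j, O.valuation (l x) < 1 := by
    -- At `j = k` the given generators have determinant in `𝔪` times the Fitting ideal; at the other
    -- indices the determinant vanishes in `K` by the choice of `P`.
    have key : ∃ y : Fin (Module.finrank R (F j)) → F j,
        Submodule.span R (Set.range y) = B j ∧ ∃ l : F j →ₗ[R] K,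
        (∀ x ∈ M j, O.valuation (l x) ≤ 1) ∧ (∃ x ∈ M j, O.valuation (l x) = 1) ∧
        ∀ i, O.valuation (l (y i)) < 1 := by
      by_cases hj : j = k
      · subst hj
        exact ⟨b, hb, exists_functional O (IsNoetherian.noetherian _) hO e (hspan hb) (hI0 j)
          (Or.inr ⟨_, hval, hmem⟩)⟩
      · refine ⟨b' j, hb' j, exists_functional O (IsNoetherian.noetherian _) hO (e' j)
          (hspan (hb' j)) (hI0 j) (Or.inl ((hker _).2 (hP _ (Finset.mem_image_of_mem _ ?_))))⟩
        simp [hj]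
    obtain ⟨y, hy, l, h1, h2, h3⟩ := key
    refine ⟨l, h1, h2, fun x hx => ?_⟩
    rw [← hy] at hx
    induction hx using Submodule.span_induction with
    | mem x hx => obtain ⟨i, rfl⟩ := hx; exact h3 i
    | zero => simp
    | add x y _ _ hx hy => rw [map_add]; exact O.valuation.map_add_lt hx hy
    | smul r x _ hx =>
      rw [map_smul, Algebra.smul_def, map_mul]
      exact (mul_le_of_le_one_left' ((O.valuation_le_one_iff _).2 (hO r))).trans_lt hx
  choose l h1 h2 h3 using hfun
  obtain ⟨j, x, hx, hlt⟩ := h.exists_valuation_eq_one O hO l h1 h2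
  exact hlt (h3 j x hx)

end Local

theorem IsJointReduction.minGenSet_extends {R : Type u} [CommRing R] [IsNoetherianRing R]
    [IsLocalRing R] {q : ℕ} {F : Fin q → Type v}
    [∀ k, AddCommGroup (F k)] [∀ k, Module R (F k)]
    [∀ k, Module.Free R (F k)] [∀ k, Module.Finite R (F k)]
    {M B : ∀ k, Submodule R (F k)} (h : IsJointReduction M B)
    (hd : ringKrullDim R = q) (hM : ∀ k, IsFiniteLength R (F k ⧸ M k)) (hM' : ∀ k, M k ≠ ⊤)
    (k : Fin q) :
    (∀ x : R, IsDetOf (B k) x → ∃ S : Set R, x ∈ S ∧ IsMinGenSet (fittingIdeal (M k)) S) ∧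
    (∀ S : Set (F k), IsMinGenSet (B k) S → ∃ T : Set (F k), S ⊆ T ∧ IsMinGenSet (M k) T) := by
  constructor
  · rintro x ⟨e, b, hb, rfl⟩
    exact exists_isMinGenSet_of_notMem (IsNoetherian.noetherian _)
      (det_mem_fittingIdeal e fun i => h.1 k (hb ▸ Submodule.subset_span ⟨i, rfl⟩))
      (h.det_notMem hd hM hM' k e hb)
  · intro S hS
    obtain ⟨b, hb⟩ := h.2.1 k
    have hbM : ∀ i, b i ∈ M k := fun i => h.1 k (hb ▸ Submodule.subset_span ⟨i, rfl⟩)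
    rw [← hb] at hS
    exact exists_isMinGenSet_of_span_indep (IsNoetherian.noetherian _) hbM
      (mem_maximalIdeal_of_det_notMem (Module.finBasis R (F k)) hbM
        (h.det_notMem hd hM hM' k _ hb)) hS

/-! ### Lengths of images modulo a submodule. -/

section RelLength

variable {R : Type u} [CommRing R] {V : Type v} [AddCommGroup V] [Module R V]
  {V' : Type w} [AddCommGroup V'] [Module R V']

/-- The length of `N` modulo `J`, that is, of `N ⧸ N ⊓ J`. -/
noncomputable def relLength (J N : Submodule R V) : ℕ∞ := Module.length R (N.map J.mkQ)

theorem relLength_mono {J N N' : Submodule R V} (h : N' ≤ N) : relLength J N' ≤ relLength J N :=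
  Module.length_le_of_injective (Submodule.inclusion (Submodule.map_mono h))
    (Submodule.inclusion_injective _)

/-- The image of `N` modulo `J` surjects onto its image modulo `J'`, and the kernel contains the
image of `N'`. -/
theorem relLength_add_le {J J' N N' : Submodule R V} (hJ : J ≤ J') (hN : N' ≤ N) (h : N' ≤ J') :
    relLength J' N + relLength J N' ≤ relLength J N := by
  let g : V ⧸ J →ₗ[R] V ⧸ J' := J.mapQ J' LinearMap.id hJ
  have hg (x : V) : g (J.mkQ x) = J'.mkQ x := rfl
  let X := N.map J.mkQ
  let p : X →ₗ[R] X.map g := g.submoduleMap X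
  have hp : Function.Surjective p := g.submoduleMap_surjective X
  have hX : X.map g = N.map J'.mkQ := by
    rw [← Submodule.map_comp]; rfl
  have h1 : Module.length R X = Module.length R (LinearMap.ker p) + Module.length R (X.map g) :=
    Module.length_eq_add_of_exact (LinearMap.ker p).subtype p (Submodule.subtype_injective _) hp
      (LinearMap.exact_subtype_ker_map p)
  have hle : N'.map J.mkQ ≤ X := Submodule.map_mono hN
  have h2 : relLength J N' ≤ Module.length R (LinearMap.ker p) := by
    refine Module.length_le_of_injective ((Submodule.inclusion hle).codRestrict _ ?_) ?_
    · rintro ⟨_, x, hx, rfl⟩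
      refine Subtype.ext ?_
      change g (J.mkQ x) = 0
      rw [hg, Submodule.mkQ_apply, Submodule.Quotient.mk_eq_zero]
      exact h hx
    · intro x y hxy
      have := congrArg Subtype.val hxy
      exact Submodule.inclusion_injective hle this
  have h3 : Module.length R (X.map g) = relLength J' N := by rw [hX]; rfl
  have h4 : relLength J N = _ := h1
  rw [h4, h3, add_comm]
  exact add_le_add_left h2 _

theorem relLength_map {J : Submodule R V} {J' : Submodule R V'} (f : V →ₗ[R] V')
    (hf : ∀ x, f x ∈ J' ↔ x ∈ J) (N : Submodule R V) :
    relLength J' (N.map f) = relLength J N := by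
  let g : V ⧸ J →ₗ[R] V' ⧸ J' := J.mapQ J' f fun x hx => (hf x).2 hx
  have hg : Function.Injective g := by
    rw [← LinearMap.ker_eq_bot, eq_bot_iff]
    intro x hx
    obtain ⟨y, rfl⟩ := J.mkQ_surjective x
    have : J'.mkQ (f y) = 0 := hx
    rw [Submodule.mkQ_apply, Submodule.Quotient.mk_eq_zero, hf] at this
    simpa using this
  have h1 : (N.map J.mkQ).map g = (N.map f).map J'.mkQ := by
    rw [← Submodule.map_comp, ← Submodule.map_comp]; rfl
  rw [relLength, relLength, ← h1]
  exact (Submodule.equivMapOfInjective g hg _).length_eq.symm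

/-- The image is a quotient of a submodule killed by `I`, so each generator contributes at most the
length of `R ⧸ I`. -/
theorem relLength_span_le {J : Submodule R V} {I : Ideal R} (s : Finset V)
    (h : I • Submodule.span R (s : Set V) ≤ J) :
    relLength J (Submodule.span R (s : Set V)) ≤ s.card * Module.length R (R ⧸ I) := by
  classical
  have hI (x : s) : I ≤ LinearMap.ker ((LinearMap.toSpanSingleton R (V ⧸ J) (J.mkQ x))) := by
    intro r hr
    rw [LinearMap.mem_ker, LinearMap.toSpanSingleton_apply, ← map_smul, Submodule.mkQ_apply,
      Submodule.Quotient.mk_eq_zero]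
    exact h (Submodule.smul_mem_smul hr (Submodule.subset_span x.2))
  let f : (s → R ⧸ I) →ₗ[R] V ⧸ J :=
    LinearMap.lsum R (fun _ : s => R ⧸ I) R fun x => Submodule.liftQ I _ (hI x)
  have hle : (Submodule.span R (s : Set V)).map J.mkQ ≤ LinearMap.range f := by
    rw [Submodule.map_span, Submodule.span_le]
    rintro _ ⟨x, hx, rfl⟩
    refine ⟨Pi.single ⟨x, hx⟩ (Submodule.Quotient.mk 1), ?_⟩
    rw [LinearMap.lsum_piSingle]
    erw [Submodule.liftQ_apply]
    simp
  calc _ ≤ Module.length R (LinearMap.range f) :=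
        Module.length_le_of_injective _ (Submodule.inclusion_injective hle)
    _ ≤ Module.length R (s → R ⧸ I) :=
        Module.length_le_of_surjective f.rangeRestrict f.surjective_rangeRestrict
    _ = _ := by rw [Module.length_pi]; simp

end RelLength

/-! ### Colength of ideals generated by powers of parameters. -/

section Length

variable {R : Type u} [CommRing R]

/-- Multiplication by `x` maps `R/(J + (y))` onto the kernel of `R/(J + (xy)) → R/(J + (x))`. -/
theorem length_quotient_sup_span_mul_le (J : Ideal R) (x y : R) :
    Module.length R (R ⧸ (J ⊔ Ideal.span {x * y})) ≤
      Module.length R (R ⧸ (J ⊔ Ideal.span {x})) + Module.length R (R ⧸ (J ⊔ Ideal.span {y})) := by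
  set K := J ⊔ Ideal.span {x * y}
  set L := J ⊔ Ideal.span {x}
  set L' := J ⊔ Ideal.span {y}
  have hKL : K ≤ L := sup_le_sup_left (Ideal.span_singleton_le_span_singleton.2 ⟨y, rfl⟩) J
  let g : R ⧸ K →ₗ[R] R ⧸ L := Submodule.mapQ K L LinearMap.id hKL
  have hg : Function.Surjective g := by
    intro z
    obtain ⟨r, rfl⟩ := Submodule.mkQ_surjective _ z
    exact ⟨Submodule.mkQ K r, rfl⟩
  have h1 := Module.length_eq_add_of_exact (LinearMap.ker g).subtype g
    (Submodule.subtype_injective _) hg (LinearMap.exact_subtype_ker_map g)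
  let f : R ⧸ L' →ₗ[R] R ⧸ K := Submodule.mapQ L' K (LinearMap.mulLeft R x) (by
    refine sup_le ?_ ?_
    · exact fun r hr => Submodule.mem_sup_left (J.mul_mem_left x hr)
    · rw [Ideal.span_singleton_le_iff_mem]
      exact Submodule.mem_sup_right (Ideal.mem_span_singleton_self _))
  have h2 : LinearMap.ker g ≤ LinearMap.range f := by
    intro z hz
    obtain ⟨r, rfl⟩ := Submodule.mkQ_surjective _ z
    have hz' : Submodule.mkQ L r = 0 := hz
    rw [Submodule.mkQ_apply, Submodule.Quotient.mk_eq_zero] at hz'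
    obtain ⟨j, hj, k, hk, rfl⟩ := Submodule.mem_sup.1 hz'
    obtain ⟨t, rfl⟩ := Ideal.mem_span_singleton'.1 hk
    refine ⟨Submodule.mkQ L' t, ?_⟩
    change Submodule.mkQ K (x * t) = Submodule.mkQ K (j + t * x)
    rw [eq_comm, ← sub_eq_zero, ← map_sub, Submodule.mkQ_apply, Submodule.Quotient.mk_eq_zero]
    have : j + t * x - x * t = j := by ring
    rw [this]
    exact Submodule.mem_sup_left hj
  rw [h1, add_comm]
  refine add_le_add_right ?_ _
  exact (Module.length_le_of_injective _ (Submodule.inclusion_injective h2)).trans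
    (Module.length_le_of_surjective f.rangeRestrict f.surjective_rangeRestrict)

theorem length_quotient_sup_span_pow_le (J : Ideal R) (x : R) (N : ℕ) :
    Module.length R (R ⧸ (J ⊔ Ideal.span {x ^ N})) ≤
      N * Module.length R (R ⧸ (J ⊔ Ideal.span {x})) := by
  induction N with
  | zero =>
    have : J ⊔ Ideal.span {x ^ 0} = ⊤ := by simp
    rw [this, Module.length_eq_zero]
    exact zero_le
  | succ N ih =>
    rw [pow_succ]
    refine (length_quotient_sup_span_mul_le J _ x).trans ?_
    rw [Nat.cast_succ, add_mul, one_mul]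
    exact add_le_add_left ih _

theorem length_quotient_sup_span_image_pow_le (s : Finset R) (J : Ideal R) (N : ℕ) :
    Module.length R (R ⧸ (J ⊔ Ideal.span ((fun x => x ^ N) '' (s : Set R)))) ≤
      (N ^ s.card : ℕ) * Module.length R (R ⧸ (J ⊔ Ideal.span (s : Set R))) := by
  classical
  induction s using Finset.induction_on generalizing J with
  | empty => rw [Finset.coe_empty, Set.image_empty]; simp
  | insert a s ha ih =>
    rw [Finset.coe_insert, Set.image_insert_eq, Ideal.span_insert, Ideal.span_insert,
      Finset.card_insert_of_notMem ha]
    have h1 := length_quotient_sup_span_pow_le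
      (J ⊔ Ideal.span ((fun x => x ^ N) '' (s : Set R))) a N
    have h2 := ih (J ⊔ Ideal.span {a})
    rw [sup_right_comm] at h2
    rw [sup_assoc, sup_comm _ (Ideal.span {a ^ N})] at h1
    rw [sup_assoc J (Ideal.span {a}) (Ideal.span (s : Set R))] at h2
    refine h1.trans ((mul_le_mul_right h2 _).trans ?_)
    rw [← mul_assoc, pow_succ', Nat.cast_mul]

/-- In a Noetherian local ring of dimension `d`, there are ideals contained in `𝔪 ^ N` whose
colength grows at most like `N ^ d`. -/
theorem exists_length_quotient_le [IsNoetherianRing R] [IsLocalRing R] {d : ℕ}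
    (hd : ringKrullDim R = d) :
    ∃ c : ℕ, ∀ N : ℕ, ∃ I : Ideal R, I ≤ maximalIdeal R ^ N ∧
      Module.length R (R ⧸ I) ≤ (N ^ d * c : ℕ) := by
  -- A system of parameters: `d` elements over which `𝔪` is a minimal prime. The ideal sought is
  -- generated by their `N`-th powers.
  obtain ⟨s, hs, hcard⟩ := (maximalIdeal R).exists_finset_card_eq_height_of_isNoetherianRing
  have h2 := maximalIdeal_height_eq_ringKrullDim (R := R)
  rw [hd] at h2
  have h3 : (maximalIdeal R).height = d := by exact_mod_cast h2
  rw [h3] at hcard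
  have hcard' : s.card = d := by exact_mod_cast hcard
  have hfin : Module.length R (R ⧸ Ideal.span (s : Set R)) ≠ ⊤ := by
    have := IsLocalRing.quotient_artinian_of_mem_minimalPrimes_of_isLocalRing _ hs
    rw [Module.length_eq_of_surjective (S := R) (R := R ⧸ Ideal.span (s : Set R))
      Ideal.Quotient.mk_surjective]
    exact Module.length_ne_top
  obtain ⟨c, hc⟩ := ENat.ne_top_iff_exists.1 hfin
  refine ⟨c, fun N => ⟨Ideal.span ((fun x => x ^ N) '' (s : Set R)), ?_, ?_⟩⟩
  · rw [Ideal.span_le]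
    rintro _ ⟨x, hx, rfl⟩
    exact Ideal.pow_mem_pow (hs.1.2 (Ideal.subset_span hx)) N
  · have := length_quotient_sup_span_image_pow_le s ⊥ N
    rw [bot_sup_eq, bot_sup_eq, ← hc, hcard'] at this
    exact_mod_cast this

end Length

/-! ### Counting generators of powers and products. -/

section Span

variable {R : Type u} [CommRing R] {A : Type v} [CommRing A] [Algebra R A]

theorem sum_span_finset {ι : Type*} [DecidableEq A] (t : Finset ι) (s : ι → Finset A) :
    ∑ i ∈ t, Submodule.span R (s i : Set A) = Submodule.span R (t.biUnion s : Set A) := by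
  classical
  induction t using Finset.induction_on with
  | empty => simp
  | insert a t ha ih =>
    rw [Finset.sum_insert ha, ih, Finset.biUnion_insert, Finset.coe_union, Submodule.span_union,
      Submodule.add_eq_sup]

/-- A power of a module with `r + 1` generators is generated by the monomials. -/
theorem exists_finset_span_pow (r : ℕ) (f : Fin (r + 1) → A) (n : ℕ) :
    ∃ s : Finset A, s.card ≤ (n + 1) ^ r ∧
      Submodule.span R (Set.range f) ^ n = Submodule.span R (s : Set A) := by
  classical
  induction r generalizing n with
  | zero =>
    refine ⟨{f 0 ^ n}, by simp, ?_⟩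
    have : Set.range f = {f 0} := by
      ext x
      simp [Set.mem_range, Fin.exists_fin_one, eq_comm]
    rw [this, Submodule.span_pow, Finset.coe_singleton, Set.singleton_pow]
  | succ r ih =>
    choose s hs hspan using ih (fun i => f i.succ)
    -- The index `i` is the total degree in the variables after the first, whose exponent `n - i` is
    -- then determined; this is why the bound has exponent `r` and not `r + 1`.
    refine ⟨(Finset.range (n + 1)).biUnion fun i => (s i).image fun y => f 0 ^ (n - i) * y, ?_, ?_⟩
    · refine Finset.card_biUnion_le.trans ?_
      calc _ ≤ ∑ i ∈ Finset.range (n + 1), (n + 1) ^ r := by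
            refine Finset.sum_le_sum fun i hi => Finset.card_image_le.trans ((hs i).trans ?_)
            exact Nat.pow_le_pow_left (Finset.mem_range.1 hi) r
        _ = _ := by rw [Finset.sum_const, Finset.card_range, smul_eq_mul, pow_succ']
    · have h1 : Set.range f = {f 0} ∪ Set.range (fun i : Fin (r + 1) => f i.succ) := by
        ext x
        simp [Set.mem_range, Fin.exists_fin_succ, eq_comm]
      rw [h1, Submodule.span_union, ← sum_span_finset, ← Submodule.add_eq_sup, add_comm, add_pow]
      refine Finset.sum_congr rfl fun i hi => ?_
      have hi' : i ≤ n := Nat.lt_succ_iff.1 (Finset.mem_range.1 hi)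
      -- Addition of submodules is idempotent, so the binomial coefficients are `1`.
      rw [natCast_eq_one (Nat.choose_pos hi').ne', mul_one, hspan, Submodule.span_pow,
        Set.singleton_pow, Submodule.span_mul_span,
        mul_comm (s i : Set A), Finset.coe_image, Set.singleton_mul]

/-- A finite product of modules is generated by the products of generators. -/
theorem exists_finset_span_prod {ι : Type*} (t : Finset ι) (N : ι → Submodule R A) (k : ι → ℕ)
    (h : ∀ i, ∃ s : Finset A, s.card ≤ k i ∧ N i = Submodule.span R (s : Set A)) :
    ∃ s : Finset A, s.card ≤ ∏ i ∈ t, k i ∧ ∏ i ∈ t, N i = Submodule.span R (s : Set A) := by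
  classical
  choose s hs hspan using h
  refine ⟨∏ i ∈ t, s i, ?_, ?_⟩
  · induction t using Finset.induction_on with
    | empty => simp
    | insert a t ha ih =>
      rw [Finset.prod_insert ha, Finset.prod_insert ha]
      exact Finset.card_mul_le.trans (Nat.mul_le_mul (hs a) ih)
  · induction t using Finset.induction_on with
    | empty =>
      rw [Finset.prod_empty, Finset.prod_empty, Submodule.one_eq_span, Finset.coe_one]
      rfl
    | insert a t ha ih =>
      rw [Finset.prod_insert ha, Finset.prod_insert ha, ih, hspan, Submodule.span_mul_span,
        Finset.coe_mul]

end Span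

/-! ### The growth estimate in a valuation ring. -/

section Growth

variable {R : Type u} [CommRing R] {K : Type w} [Field K] [Algebra R K]

theorem mul_smul_mul_le {A : Type*} [CommRing A] [Algebra R A] (I J : Ideal R)
    (M N : Submodule R A) : (I * J) • (M * N) ≤ (I • M) * (J • N) := by
  rw [Submodule.smul_le]
  intro r hr x hx
  refine Submodule.mul_induction_on hr (fun i hi j hj => ?_) fun r r' hr hr' => ?_
  · refine Submodule.mul_induction_on hx (fun y hy z hz => ?_) fun y z hy hz => ?_
    · rw [← smul_mul_smul_comm]
      exact Submodule.mul_mem_mul (Submodule.smul_mem_smul hi hy) (Submodule.smul_mem_smul hj hz)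
    · rw [smul_add]
      exact add_mem hy hz
  · rw [add_smul]
    exact add_mem hr hr'

/-- The elements of valuation smaller than that of `a`. -/
def valBall (O : ValuationSubring K) (hR : ∀ r : R, algebraMap R K r ∈ O) {a : K} (ha : a ≠ 0) :
    Submodule R K where
  carrier := {x | O.valuation x < O.valuation a}
  add_mem' := fun {_ _} hx hy => O.valuation.map_add_lt hx hy
  zero_mem' := by
    rw [Set.mem_ofPred_eq, map_zero, zero_lt_iff, Ne, Valuation.zero_iff]
    exact ha
  smul_mem' := fun r x hx => by
    rw [Set.mem_ofPred_eq, Algebra.smul_def, map_mul]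
    exact (mul_le_of_le_one_left' ((O.valuation_le_one_iff _).2 (hR r))).trans_lt hx

theorem mem_valBall {O : ValuationSubring K} {hR : ∀ r : R, algebraMap R K r ∈ O} {a : K}
    {ha : a ≠ 0} {x : K} : x ∈ valBall O hR ha ↔ O.valuation x < O.valuation a := Iff.rfl

/-- For modules `Y ≤ W` over a local ring `R` of dimension `d`, with `Y` in a dominating valuation
ring and `𝔪 ^ c W ≤ Y`, the growth of the image of `Y ^ n` in the residue field has degree smaller
by one than that expected from `W` and `d`. -/
theorem exists_relLength_pow_le [IsNoetherianRing R] [IsLocalRing R] {d : ℕ}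
    (hd : ringKrullDim R = d) (O : ValuationSubring K) (hR : ∀ r : R, algebraMap R K r ∈ O)
    (hm : ∀ x ∈ maximalIdeal R, O.valuation (algebraMap R K x) < 1)
    (hx : ∃ x ∈ maximalIdeal R, algebraMap R K x ≠ 0) {Y W : Submodule R K} (hYW : Y ≤ W)
    (hYO : ∀ y ∈ Y, O.valuation y ≤ 1) {c : ℕ} (hc : maximalIdeal R ^ c • W ≤ Y) {g : ℕ}
    (hg : ∀ n : ℕ, ∃ s : Finset K, s.card ≤ (n + 1) ^ g ∧ W ^ n = Submodule.span R (s : Set K)) :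
    ∃ C : ℕ, ∀ n : ℕ,
      (n + 1 : ℕ) * relLength (valBall O hR one_ne_zero) (Y ^ n) ≤
        (C * (n + 1) ^ (g + d) : ℕ) := by
  -- Take `a` in the image of `𝔪` of largest valuation, so that `𝔪 ^ k` has valuation at most that
  -- of `a ^ k`.
  obtain ⟨a, ha0, ham⟩ : ∃ a : K, a ≠ 0 ∧ (∃ a' ∈ maximalIdeal R, a = algebraMap R K a') ∧
      ∀ x ∈ maximalIdeal R, O.valuation (algebraMap R K x) ≤ O.valuation a := by
    obtain ⟨s, hs⟩ := IsNoetherian.noetherian (maximalIdeal R)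
    have hne : s.Nonempty := by
      rw [Finset.nonempty_iff_ne_empty]
      rintro rfl
      obtain ⟨x, hx, hx0⟩ := hx
      rw [← hs] at hx
      simp at hx
      exact hx0 (by rw [hx, map_zero])
    obtain ⟨y, hy, hmax⟩ := s.exists_max_image (fun y => O.valuation (algebraMap R K y)) hne
    have hle : ∀ x ∈ maximalIdeal R,
        O.valuation (algebraMap R K x) ≤ O.valuation (algebraMap R K y) := by
      intro x hx
      rw [← hs] at hx
      induction hx using Submodule.span_induction with
      | mem x hx => exact hmax x hx
      | zero => simp
      | add x y _ _ hx hy =>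
        rw [map_add]; exact (O.valuation.map_add _ _).trans (max_le hx hy)
      | smul r x _ hx =>
        rw [smul_eq_mul, map_mul, map_mul]
        exact (mul_le_of_le_one_left' ((O.valuation_le_one_iff _).2 (hR r))).trans hx
    refine ⟨algebraMap R K y, ?_, ⟨y, hs ▸ Submodule.subset_span hy, rfl⟩, hle⟩
    intro h0
    obtain ⟨x, hx, hx0⟩ := hx
    have := hle x hx
    rw [h0, map_zero, le_zero_iff, Valuation.zero_iff] at this
    exact hx0 this
  obtain ⟨⟨a', ha'm, haa'⟩, hmax⟩ := ham
  have hva : O.valuation a < 1 := haa' ▸ hm a' ha'm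
  have hva0 : 0 < O.valuation a := by rwa [zero_lt_iff, Ne, Valuation.zero_iff]
  have hYn (n : ℕ) : ∀ y ∈ Y ^ n, O.valuation y ≤ 1 := by
    intro y hy
    induction hy using Submodule.pow_induction_on_left' with
    | algebraMap r => exact (O.valuation_le_one_iff _).2 (hR r)
    | add x y i _ _ hx hy => exact (O.valuation.map_add _ _).trans (max_le hx hy)
    | mem_mul x hx i y _ hy => rw [map_mul]; exact mul_le_one' (hYO x hx) hy
  -- lower bound for the length
  have hlow (n i : ℕ) : (i + 1 : ℕ) * relLength (valBall O hR one_ne_zero) (Y ^ n) ≤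
      relLength (valBall O hR (pow_ne_zero i ha0)) (W ^ n) := by
    induction i with
    | zero =>
      have : valBall O hR (pow_ne_zero 0 ha0) = valBall O hR one_ne_zero := by
        ext x; simp [mem_valBall]
      rw [this, zero_add, Nat.cast_one, one_mul]
      exact relLength_mono (pow_le_pow_left' hYW n)
    | succ i ih =>
      rw [Nat.cast_succ, add_mul, one_mul]
      -- Multiplication by `a ^ (i + 1)` moves a copy of the image of `Y ^ n` into `W ^ n`, one
      -- layer deeper in the filtration by valuation; each layer adds the same length.
      have h1 : relLength (valBall O hR one_ne_zero) (Y ^ n) =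
          relLength (valBall O hR (pow_ne_zero (i + 1) ha0))
            ((Y ^ n).map (LinearMap.mulLeft R (a ^ (i + 1)))) := by
        refine (relLength_map _ (fun x => ?_) _).symm
        rw [mem_valBall, mem_valBall, LinearMap.mulLeft_apply, map_mul, map_one]
        exact mul_lt_iff_lt_one_right (by rw [map_pow]; exact pow_pos hva0 _)
      refine (add_le_add_left ih _).trans ?_
      rw [h1]
      refine relLength_add_le ?_ ?_ ?_
      · intro x hx
        rw [mem_valBall] at hx ⊢
        refine hx.trans_le ?_
        rw [map_pow, map_pow]
        exact pow_le_pow_right_of_le_one' hva.le (Nat.le_succ i)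
      · rintro _ ⟨y, hy, rfl⟩
        rw [LinearMap.mulLeft_apply, haa', ← map_pow, ← Algebra.smul_def]
        exact Submodule.smul_mem _ _ (pow_le_pow_left' hYW n hy)
      · rintro _ ⟨y, hy, rfl⟩
        rw [mem_valBall, LinearMap.mulLeft_apply, map_mul, pow_succ]
        refine (mul_le_of_le_one_right' (hYn n y hy)).trans_lt ?_
        rw [map_mul]
        exact mul_lt_of_lt_one_right (by rw [map_pow]; exact pow_pos hva0 _) hva
  -- upper bound for the length
  have hpow (n : ℕ) : (maximalIdeal R ^ c) ^ n • W ^ n ≤ Y ^ n := by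
    induction n with
    | zero => simp
    | succ n ih =>
      rw [pow_succ, pow_succ, pow_succ]
      exact (mul_smul_mul_le _ _ _ _).trans (mul_le_mul' ih hc)
  have hmO (k : ℕ) (r : R) (hr : r ∈ maximalIdeal R ^ k) :
      O.valuation (algebraMap R K r) ≤ O.valuation (a ^ k) := by
    induction k generalizing r with
    | zero => simpa using (O.valuation_le_one_iff _).2 (hR r)
    | succ k ih =>
      rw [pow_succ] at hr
      refine Submodule.mul_induction_on hr (fun x hx y hy => ?_) fun x y hx hy => ?_
      · rw [map_mul, map_mul, pow_succ, map_mul]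
        exact mul_le_mul' (ih x hx) (hmax y hy)
      · rw [map_add]
        exact (O.valuation.map_add _ _).trans (max_le hx hy)
  have hmem (n : ℕ) : maximalIdeal R ^ ((c + 1) * (n + 1)) • W ^ n ≤
      valBall O hR (pow_ne_zero n ha0) := by
    -- Of the exponent, `c * n` is spent to bring `W ^ n` into `Y ^ n`, and `n + 1` to push the
    -- valuation strictly below that of `a ^ n`.
    have h1 : maximalIdeal R ^ ((c + 1) * (n + 1)) ≤
        maximalIdeal R ^ (n + 1) * (maximalIdeal R ^ c) ^ n := by
      rw [← pow_mul, ← pow_add]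
      exact Ideal.pow_le_pow_right (by ring_nf; omega)
    refine (Submodule.smul_mono_left h1).trans ?_
    rw [mul_smul]
    refine (smul_mono_right _ (hpow n)).trans ?_
    rw [Submodule.smul_le]
    intro r hr y hy
    rw [mem_valBall, Algebra.smul_def, map_mul]
    refine (mul_le_mul' (hmO _ r hr) (hYn n y hy)).trans_lt ?_
    rw [mul_one, pow_succ, map_mul]
    exact mul_lt_of_lt_one_right (by rw [map_pow]; exact pow_pos hva0 _) hva
  obtain ⟨l, hl⟩ := exists_length_quotient_le hd
  -- With `n + 1` layers the lower bound gains a factor `n + 1`, while the upper bound is the number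
  -- of generators of `W ^ n` times a colength of order `(n + 1) ^ d`.
  refine ⟨(c + 1) ^ d * l, fun n => (hlow n n).trans ?_⟩
  obtain ⟨s, hs, hspan⟩ := hg n
  obtain ⟨I, hI, hIl⟩ := hl ((c + 1) * (n + 1))
  have h2 := relLength_span_le (J := valBall O hR (pow_ne_zero n ha0)) (I := I) s
    (by rw [← hspan]; exact (Submodule.smul_mono_left hI).trans (hmem n))
  rw [← hspan] at h2
  refine h2.trans ((mul_le_mul' (Nat.cast_le.2 hs) hIl).trans ?_)
  rw [← Nat.cast_mul, Nat.cast_le]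
  apply le_of_eq
  rw [mul_pow, pow_add]
  ring

end Growth

open Polynomial

/-! ### Chains of primes in the Rees algebra. -/

section Rees

variable {R : Type u} [CommRing R] {S : Type v} [CommRing S] [Algebra R S]

/-- The module `U t` in `S[t]`. -/
noncomputable def degOne (U : Submodule R S) : Submodule R S[X] :=
  Submodule.span R {X} * U.map (CAlgHom (R := R) (A := S)).toLinearMap

/-- The Rees algebra `R[U t]` in `S[t]`. -/
noncomputable def rees (U : Submodule R S) : Subalgebra R S[X] :=
  Algebra.adjoin R (degOne U : Set S[X])

/-- The module `U t` in the Rees algebra. -/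
noncomputable def reesGen (U : Submodule R S) : Submodule R (rees U) :=
  (degOne U).comap (rees U).val.toLinearMap

theorem mem_degOne {U : Submodule R S} {f : S[X]} : f ∈ degOne U ↔ ∃ u ∈ U, X * C u = f := by
  constructor
  · intro h
    obtain ⟨z, ⟨u, hu, rfl⟩, rfl⟩ := Submodule.mem_span_singleton_mul.1 h
    exact ⟨u, hu, rfl⟩
  · rintro ⟨u, hu, rfl⟩
    exact Submodule.mul_mem_mul (Submodule.mem_span_singleton_self _) ⟨u, hu, rfl⟩

theorem degOne_mono {U U' : Submodule R S} (h : U ≤ U') : degOne U ≤ degOne U' :=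
  mul_le_mul' le_rfl (Submodule.map_mono h)

theorem degOne_le_rees (U : Submodule R S) : degOne U ≤ (rees U).toSubmodule :=
  Algebra.subset_adjoin

theorem map_reesGen (U : Submodule R S) :
    (reesGen U).map (rees U).val.toLinearMap = degOne U := by
  rw [reesGen, Submodule.map_comap_eq, inf_eq_right]
  intro f hf
  exact ⟨⟨f, degOne_le_rees U hf⟩, rfl⟩

theorem coeff_mem_pow {U : Submodule R S} {f : S[X]} (hf : f ∈ rees U) (n : ℕ) :
    f.coeff n ∈ U ^ n := by
  induction hf using Algebra.adjoin_induction generalizing n with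
  | mem f hf =>
    obtain ⟨u, hu, rfl⟩ := mem_degOne.1 hf
    rw [X_mul, coeff_C_mul, coeff_X]
    split_ifs with h
    · subst h; simpa using hu
    · simp
  | algebraMap r =>
    rw [Polynomial.algebraMap_apply, coeff_C]
    split_ifs with h
    · subst h
      rw [pow_zero]
      exact Submodule.algebraMap_mem r
    · exact zero_mem _
  | add f g _ _ hf hg => rw [coeff_add]; exact add_mem (hf n) (hg n)
  | mul f g _ _ hf hg =>
    rw [coeff_mul]
    refine Submodule.sum_mem _ fun p hp => ?_
    rw [← Finset.HasAntidiagonal.mem_antidiagonal.1 hp, pow_add]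
    exact Submodule.mul_mem_mul (hf _) (hg _)

theorem isNoetherianRing_rees [IsNoetherianRing R] {U : Submodule R S} (hU : U.FG) :
    IsNoetherianRing (rees U) := by
  have h : (degOne U).FG := Submodule.FG.mul (Submodule.fg_span_singleton X) (hU.map _)
  obtain ⟨s, hs⟩ := h
  refine isNoetherianRing_of_fg ⟨s, ?_⟩
  rw [rees, ← hs, Algebra.adjoin_span]

/-- The growth function at a prime of the Rees algebra. -/
noncomputable def growth {U : Submodule R S} (P : Ideal (rees U)) (n : ℕ) : ℕ∞ :=
  relLength (P.restrictScalars R) (reesGen U ^ n)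

theorem one_le_growth {U : Submodule R S} {P : Ideal (rees U)} {n : ℕ} {y : rees U}
    (hy : y ∈ reesGen U ^ n) (hyP : y ∉ P) : 1 ≤ growth P n := by
  rw [Order.one_le_iff_pos, growth, relLength, Module.length_pos_iff]
  refine ⟨⟨⟨_, Submodule.mem_map_of_mem hy⟩, 0, fun h0 => ?_⟩⟩
  have h1 := congrArg Subtype.val h0
  change (P.restrictScalars R).mkQ y = 0 at h1
  rw [Submodule.mkQ_apply, Submodule.Quotient.mk_eq_zero] at h1
  exact hyP h1

theorem one_le_growth_zero {U : Submodule R S} {P : Ideal (rees U)} [P.IsPrime] :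
    1 ≤ growth P 0 :=
  one_le_growth (y := 1) (by rw [pow_zero]; exact Submodule.one_le.1 le_rfl)
    ((Ideal.ne_top_iff_one P).1 (Ideal.IsPrime.ne_top ‹_›))

/-- Multiplication by `θ` is injective modulo the prime `P`, and its image vanishes modulo `Q`. -/
theorem growth_add_le {U : Submodule R S} {P Q : Ideal (rees U)} [P.IsPrime] (hPQ : P ≤ Q)
    {θ : rees U} (hθ : θ ∈ reesGen U) (hQ : θ ∈ Q) (hP : θ ∉ P) (n : ℕ) :
    growth Q (n + 1) + growth P n ≤ growth P (n + 1) := by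
  have h1 : growth P n = relLength (P.restrictScalars R)
      ((reesGen U ^ n).map (LinearMap.mulLeft R θ)) := by
    refine (relLength_map _ (fun x => ?_) _).symm
    change θ * x ∈ P ↔ x ∈ P
    exact ⟨fun h => (Ideal.IsPrime.mem_or_mem ‹_› h).resolve_left hP, P.mul_mem_left θ⟩
  rw [h1]
  refine relLength_add_le hPQ ?_ ?_
  · rintro _ ⟨y, hy, rfl⟩
    rw [pow_succ']
    exact Submodule.mul_mem_mul hθ hy
  · rintro _ ⟨y, -, rfl⟩
    exact Q.mul_mem_right y hQ

/-- There is a chain of `n` primes lying below `Q` and containing the ideal `J` of the base ring,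
the successive inclusions being strict in degree one. -/
def HasChain {U : Submodule R S} (J : Ideal R) : ℕ → Ideal (rees U) → Prop
  | 0, _ => True
  | n + 1, Q => ∃ P : Ideal (rees U), P.IsPrime ∧ (∀ r ∈ J, algebraMap R (rees U) r ∈ P) ∧
      P ≤ Q ∧ (∃ θ ∈ reesGen U, θ ∈ Q ∧ θ ∉ P) ∧ HasChain J n P

/-- Each step down the chain sums the growth function by `growth_add_le`, raising the degree of the
binomial lower bound by one. -/
theorem HasChain.exists_growth {U : Submodule R S} {J : Ideal R} {n : ℕ} {Q : Ideal (rees U)}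
    (h : HasChain J n Q) [Q.IsPrime] (hJ : ∀ r ∈ J, algebraMap R (rees U) r ∈ Q)
    (hQ : ∃ θ ∈ reesGen U, θ ∉ Q) (i : ℕ) (hi : ∀ j, ((j + i).choose i : ℕ) ≤ growth Q j) :
    ∃ P : Ideal (rees U), P.IsPrime ∧ (∀ r ∈ J, algebraMap R (rees U) r ∈ P) ∧
      (∃ θ ∈ reesGen U, θ ∉ P) ∧ ∀ j, ((j + (i + n)).choose (i + n) : ℕ) ≤ growth P j := by
  induction n generalizing Q i with
  | zero => exact ⟨Q, ‹_›, hJ, hQ, hi⟩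
  | succ n ih =>
    obtain ⟨P, hP, hJP, hPQ, ⟨θ, hθ, hθQ, hθP⟩, hc⟩ := h
    have := ih hc hJP ⟨θ, hθ, hθP⟩ (i + 1) (fun j => by
      induction j with
      | zero => simpa using one_le_growth_zero
      | succ j ihj =>
        refine le_trans ?_ (growth_add_le hPQ hθ hθQ hθP j)
        refine le_trans (le_of_eq ?_) (add_le_add (hi (j + 1)) ihj)
        -- Pascal's rule.
        rw [← Nat.cast_add, Nat.cast_inj, show j + 1 + (i + 1) = (j + 1 + i) + 1 by ring,
          Nat.choose_succ_succ, show j + (i + 1) = j + 1 + i by ring])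
    rwa [show i + (n + 1) = i + 1 + n by ring]

/-- A bound of the growth function at a prime `P` over the maximal ideal, given a map to a field
whose kernel on the Rees algebra lies in `P`. -/
theorem exists_growth_le_of_algHom [IsNoetherianRing R] [IsLocalRing R] {d : ℕ}
    (hd : ringKrullDim R = d) {U E : Submodule R S} (hUE : U ≤ E) {c : ℕ}
    (hc : maximalIdeal R ^ c • E ≤ U) {g : ℕ}
    (hg : ∀ n : ℕ, ∃ s : Finset S, s.card ≤ (n + 1) ^ g ∧ E ^ n = Submodule.span R (s : Set S))
    (P : Ideal (rees U)) [P.IsPrime]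
    (hP : ∀ r ∈ maximalIdeal R, algebraMap R (rees U) r ∈ P)
    {K : Type*} [Field K] [Algebra R K] (ψ : S[X] →ₐ[R] K)
    (hψP : ∀ a : rees U, a ∉ P → ψ a ≠ 0)
    (hψm : ∃ x ∈ maximalIdeal R, ψ (algebraMap R S[X] x) ≠ 0) :
    ∃ C : ℕ, ∀ n : ℕ, (n + 1 : ℕ) * growth P n ≤ (C * (n + 1) ^ (g + d) : ℕ) := by
  classical
  let φ : rees U →ₐ[R] K := ψ.comp (rees U).val
  have hφ (y : P.primeCompl) : IsUnit (φ.toRingHom y) := by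
    rw [isUnit_iff_ne_zero]
    exact hψP y y.2
  -- Passing to the localization at `P` makes `O` dominate it, so an element of the Rees algebra has
  -- valuation below one exactly when it lies in `P`.
  let φ' : Localization.AtPrime P →+* K := IsLocalization.lift hφ
  have hφ' (a : rees U) : φ' (algebraMap _ _ a) = φ a := IsLocalization.lift_eq hφ a
  obtain ⟨O, hO, hloc⟩ :=
    exists_factor_valuationRing (R := Localization.AtPrime P) (K := K) φ'
  have hOA (a : rees U) : φ a ∈ O := hφ' a ▸ hO _
  have hR (r : R) : algebraMap R K r ∈ O := by
    have := hOA (algebraMap R _ r)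
    rwa [AlgHom.commutes] at this
  have hPO (a : rees U) : O.valuation (φ a) < 1 ↔ a ∈ P := by
    rw [← IsLocalization.AtPrime.to_map_mem_maximal_iff (Localization.AtPrime P) P a]
    have h1 := ValuationSubring.valuation_lt_one_iff O ⟨_, hO (algebraMap _ _ a)⟩
    change _ ↔ O.valuation (φ' _) < 1 at h1
    rw [← hφ', ← h1]
    constructor
    · intro h hu
      exact h (hu.map (φ'.codRestrict O.toSubring hO))
    · intro h hu
      exact h (hloc.map_nonunit _ hu)
  have hYW := Submodule.map_mono (f := ψ.toLinearMap) (degOne_mono hUE)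
  obtain ⟨C, hC⟩ := exists_relLength_pow_le hd O hR (fun r hr => by
      rw [← φ.commutes, hPO]; exact hP r hr)
    (by
      obtain ⟨x, hx, hx0⟩ := hψm
      exact ⟨x, hx, by rwa [← ψ.commutes]⟩) hYW (by
      rintro _ ⟨f, hf, rfl⟩
      exact (O.valuation_le_one_iff _).2 (hOA ⟨f, degOne_le_rees U hf⟩)) (c := c) (by
      rw [← Submodule.map_smul'']
      refine Submodule.map_mono ?_
      have h1 := mul_smul_mul_le (⊤ : Ideal R) (maximalIdeal R ^ c) (Submodule.span R {X})
        (E.map (CAlgHom (R := R) (A := S)).toLinearMap)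
      rw [Ideal.top_mul, Submodule.top_smul, ← Submodule.map_smul''] at h1
      exact h1.trans (mul_le_mul' le_rfl (Submodule.map_mono hc))) (g := g) (fun n => by
      obtain ⟨s, hs, hspan⟩ := hg n
      refine ⟨s.image fun y => ψ (X ^ n * C y), Finset.card_image_le.trans hs, ?_⟩
      rw [← Submodule.map_pow, degOne, mul_pow, ← Submodule.map_pow, hspan, Submodule.map_span,
        Submodule.span_pow, Set.singleton_pow, Submodule.span_mul_span, Submodule.map_span,
        Set.singleton_mul, Set.image_image, Set.image_image, Finset.coe_image]
      rfl)
  refine ⟨C, fun n => ?_⟩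
  have h1 : growth P n = relLength (valBall O hR one_ne_zero)
      (((degOne U).map ψ.toLinearMap) ^ n) := by
    rw [← map_reesGen U, ← Submodule.map_comp]
    change _ = relLength _ (((reesGen U).map φ.toLinearMap) ^ n)
    rw [← Submodule.map_pow]
    refine (relLength_map _ (fun a => ?_) _).symm
    rw [mem_valBall, map_one]
    exact hPO a
  rw [h1]
  exact hC n

/-- The growth function at a prime over the maximal ideal which does not contain `U t`. -/
theorem exists_growth_le [IsNoetherianRing R] [IsLocalRing R] {d : ℕ}
    (hd : ringKrullDim R = d) {x : R} (hxm : x ∈ maximalIdeal R)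
    (hx : ∀ s : S, x • s = 0 → s = 0) {U E : Submodule R S} (hUE : U ≤ E) {c : ℕ}
    (hc : maximalIdeal R ^ c • E ≤ U) {g : ℕ}
    (hg : ∀ n : ℕ, ∃ s : Finset S, s.card ≤ (n + 1) ^ g ∧ E ^ n = Submodule.span R (s : Set S))
    (P : Ideal (rees U)) [P.IsPrime]
    (hP : ∀ r ∈ maximalIdeal R, algebraMap R (rees U) r ∈ P) :
    ∃ C : ℕ, ∀ n : ℕ, (n + 1 : ℕ) * growth P n ≤ (C * (n + 1) ^ (g + d) : ℕ) := by
  classical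
  have hx' : ∀ (i : ℕ) (f : S[X]), x ^ i • f = 0 → f = 0 := by
    intro i
    induction i with
    | zero => intro f hf; simpa using hf
    | succ i ih =>
      intro f hf
      rw [pow_succ, mul_smul] at hf
      have := ih _ hf
      ext j
      exact hx _ (by simpa using congrArg (fun p => p.coeff j) this)
  -- The prime `p` avoids all products of powers of `x` and elements outside `P`. So it contracts
  -- into `P`, and the nonzerodivisor `x` of `𝔪` survives in the fraction field of `S[X] ⧸ p`.
  obtain ⟨p, hp, -, hpd⟩ := Ideal.exists_le_prime_disjoint (⊥ : Ideal S[X])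
    (Submonoid.powers (algebraMap R S[X] x) ⊔ P.primeCompl.map (rees U).val) (by
      rw [Set.disjoint_left]
      rintro _ rfl h0
      obtain ⟨_, ⟨i, rfl⟩, _, ⟨w, hw, rfl⟩, hyz⟩ := Submonoid.mem_sup.1 h0
      have h1 : x ^ i • (w : S[X]) = 0 := by
        rw [Algebra.smul_def, map_pow]; exact hyz
      have h2 : w = 0 := Subtype.ext (hx' i _ h1)
      exact hw (h2 ▸ P.zero_mem))
  let K := FractionRing (S[X] ⧸ p)
  let ψ : S[X] →ₐ[R] K :=
    (IsScalarTower.toAlgHom R (S[X] ⧸ p) K).comp (Ideal.Quotient.mkₐ R p)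
  have hψ (f : S[X]) : ψ f = 0 ↔ f ∈ p := by
    change algebraMap (S[X] ⧸ p) K (Ideal.Quotient.mk p f) = 0 ↔ _
    rw [map_eq_zero_iff _ (IsFractionRing.injective (S[X] ⧸ p) K)]
    exact Ideal.Quotient.eq_zero_iff_mem
  refine exists_growth_le_of_algHom hd hUE hc hg P hP ψ (fun a ha h0 => ?_)
    ⟨x, hxm, fun h0 => ?_⟩
  · exact Set.disjoint_left.1 hpd ((hψ _).1 h0) (Submonoid.mem_sup_right ⟨a, ha, rfl⟩)
  · exact Set.disjoint_left.1 hpd ((hψ _).1 h0) (Submonoid.mem_sup_left (Submonoid.mem_powers _))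

/-- Chains of primes over the maximal ideal that do not contain `U t` have length
less than `g + d`. -/
theorem not_hasChain [IsNoetherianRing R] [IsLocalRing R] {d : ℕ}
    (hd : ringKrullDim R = d) {x : R} (hxm : x ∈ maximalIdeal R)
    (hx : ∀ s : S, x • s = 0 → s = 0) {U E : Submodule R S} (hUE : U ≤ E) {c : ℕ}
    (hc : maximalIdeal R ^ c • E ≤ U) {g : ℕ}
    (hg : ∀ n : ℕ, ∃ s : Finset S, s.card ≤ (n + 1) ^ g ∧ E ^ n = Submodule.span R (s : Set S))
    (Q : Ideal (rees U)) [Q.IsPrime]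
    (hQm : ∀ r ∈ maximalIdeal R, algebraMap R (rees U) r ∈ Q) (hQ : ∃ θ ∈ reesGen U, θ ∉ Q)
    {n : ℕ} (hn : g + d ≤ n) : ¬ HasChain (maximalIdeal R) n Q := by
  intro h
  obtain ⟨P, hP, hPm, -, hgr⟩ := h.exists_growth hQm hQ 0 (fun j => by
    obtain ⟨θ, hθ, hθQ⟩ := hQ
    simpa using one_le_growth (Submodule.pow_mem_pow _ hθ j)
      fun h => hθQ (Ideal.IsPrime.mem_of_pow_mem ‹_› j h))
  obtain ⟨C, hC⟩ := exists_growth_le hd hxm hx hUE hc hg P hPm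
  simp only [zero_add] at hgr
  have key (j : ℕ) : (j + 1) * (j + n).choose n ≤ C * (j + 1) ^ n := by
    have h1 := (mul_le_mul_right (hgr j) (((j + 1 : ℕ) : ℕ∞))).trans (hC j)
    have h2 : (j + 1) * (j + n).choose n ≤ C * (j + 1) ^ (g + d) := by exact_mod_cast h1
    exact h2.trans (Nat.mul_le_mul_left _ (Nat.pow_le_pow_right (Nat.succ_pos j) hn))
  -- The binomial coefficient has order `(j + 1) ^ n`, so `key` bounds `j + 1` by a constant.
  have h3 (j : ℕ) : (j + 1) ^ n ≤ n.factorial * (j + n).choose n := by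
    rw [← Nat.ascFactorial_eq_factorial_mul_choose]
    exact Nat.pow_succ_le_ascFactorial (j + 1) n
  have h4 (j : ℕ) : j + 1 ≤ n.factorial * C := by
    have h5 : (j + 1) * (j + 1) ^ n ≤ (n.factorial * C) * (j + 1) ^ n := by
      calc _ ≤ (j + 1) * (n.factorial * (j + n).choose n) := Nat.mul_le_mul_left _ (h3 j)
        _ = n.factorial * ((j + 1) * (j + n).choose n) := by ring
        _ ≤ n.factorial * (C * (j + 1) ^ n) := Nat.mul_le_mul_left _ (key j)
        _ = _ := by ring
    exact Nat.le_of_mul_le_mul_right h5 (pow_pos (Nat.succ_pos j) n)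
  exact absurd (h4 (n.factorial * C)) (by omega)

end Rees

/-- Over a local ring with infinite residue field, a finitely generated module is not covered by
finitely many proper submodules. -/
theorem exists_mem_forall_notMem {R : Type u} [CommRing R] [IsLocalRing R]
    [Infinite (ResidueField R)] {V : Type v} [AddCommGroup V] [Module R V] {M : Submodule R V}
    (hM : M.FG) {𝒩 : Set (Submodule R V)} (hfin : 𝒩.Finite) (h : ∀ N ∈ 𝒩, ¬ M ≤ N) :
    ∃ v ∈ M, ∀ N ∈ 𝒩, v ∉ N := by
  classical
  let _ : Field (R ⧸ maximalIdeal R) := Ideal.Quotient.field _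
  have : Infinite (R ⧸ maximalIdeal R) := ‹Infinite (ResidueField R)›
  let J : Submodule R M := maximalIdeal R • (⊤ : Submodule R M)
  let W (N : Submodule R V) : Submodule (R ⧸ maximalIdeal R) (M ⧸ J) :=
    Submodule.span _ (J.mkQ '' (N.comap M.subtype : Submodule R M))
  have hW (N : Submodule R V) :
      (W N).restrictScalars R = (N.comap M.subtype).map J.mkQ := by
    rw [Submodule.restrictScalars_span R _ Ideal.Quotient.mk_surjective, ← Submodule.map_span,
      Submodule.span_eq]
  -- By Nakayama the submodules stay proper in `M/𝔪M`, and a vector space over an infinite field is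
  -- not a finite union of proper subspaces.
  have htop : (⊤ : Submodule (R ⧸ maximalIdeal R) (M ⧸ J)) ∉ hfin.toFinset.image W := by
    intro hmem
    obtain ⟨N, hN, hNW⟩ := Finset.mem_image.1 hmem
    rw [Set.Finite.mem_toFinset] at hN
    have h1 := hW N
    rw [hNW, Submodule.restrictScalars_top] at h1
    have h2 : (⊤ : Submodule R M) ≤ N.comap M.subtype := by
      refine Submodule.le_of_le_smul_of_le_jacobson_bot (Module.Finite.iff_fg.2 hM).1
        (maximalIdeal_le_jacobson _) fun x _ => ?_
      have hx : J.mkQ x ∈ (N.comap M.subtype).map J.mkQ := h1 ▸ trivial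
      obtain ⟨y, hy, hyx⟩ := hx
      have h4 : x - y ∈ J := by
        rw [← Submodule.Quotient.mk_eq_zero, ← Submodule.mkQ_apply, map_sub, hyx, sub_self]
      simpa using Submodule.add_mem_sup hy h4
    exact h N hN fun x hx => h2 (x := ⟨x, hx⟩) trivial
  have hne := Subspace.biUnion_ne_univ_of_top_notMem htop
  obtain ⟨w, hw⟩ := (Set.ne_univ_iff_exists_notMem _).1 hne
  obtain ⟨v, rfl⟩ := J.mkQ_surjective w
  refine ⟨v, v.2, fun N hN hvN => hw ?_⟩
  simp only [Set.mem_iUnion]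
  exact ⟨W N, Finset.mem_image_of_mem _ (hfin.mem_toFinset.2 hN),
    Submodule.subset_span ⟨v, hvN, rfl⟩⟩

/-! ### From primes of the Rees algebra to powers of `U`. -/

section Rees

variable {R : Type u} [CommRing R] {S : Type v} [CommRing S] [Algebra R S]

theorem exists_mem_reesGen_pow {U : Submodule R S} {n : ℕ} {z : S} (hz : z ∈ U ^ n) :
    ∃ θ ∈ reesGen U ^ n, (θ : S[X]) = X ^ n * C z := by
  have h1 : X ^ n * C z ∈ degOne U ^ n := by
    rw [degOne, mul_pow, Submodule.span_pow, Set.singleton_pow, ← Submodule.map_pow]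
    exact Submodule.mul_mem_mul (Submodule.mem_span_singleton_self _) ⟨z, hz, rfl⟩
  rw [← map_reesGen, ← Submodule.map_pow] at h1
  exact h1

/-- The elements of `Y` whose products with `Z`, placed in degree one, lie in `Q`. -/
def killed {U Y Z : Submodule R S} (h : Y * Z ≤ U) (Q : Ideal (rees U)) : Submodule R S where
  carrier := {y | y ∈ Y ∧ ∀ z ∈ Z, ∀ θ : rees U, (θ : S[X]) = X * C (y * z) → θ ∈ Q}
  add_mem' := by
    rintro y y' ⟨hy, hyQ⟩ ⟨hy', hyQ'⟩
    refine ⟨add_mem hy hy', fun z hz θ hθ => ?_⟩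
    have h1 := degOne_le_rees U (mem_degOne.2 ⟨_, h (Submodule.mul_mem_mul hy hz), rfl⟩)
    have h2 := degOne_le_rees U (mem_degOne.2 ⟨_, h (Submodule.mul_mem_mul hy' hz), rfl⟩)
    have h3 : θ = ⟨_, h1⟩ + ⟨_, h2⟩ := Subtype.ext (by
      rw [hθ, add_mul, C_add, mul_add]; rfl)
    rw [h3]
    exact add_mem (hyQ z hz _ rfl) (hyQ' z hz _ rfl)
  zero_mem' := by
    refine ⟨zero_mem _, fun z _ θ hθ => ?_⟩
    have : θ = 0 := Subtype.ext (by rw [hθ]; simp)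
    rw [this]
    exact zero_mem _
  smul_mem' := by
    rintro r y ⟨hy, hyQ⟩
    refine ⟨Submodule.smul_mem _ _ hy, fun z hz θ hθ => ?_⟩
    have h1 := degOne_le_rees U (mem_degOne.2 ⟨_, h (Submodule.mul_mem_mul hy hz), rfl⟩)
    have h3 : θ = r • ⟨_, h1⟩ := Subtype.ext (by
      rw [hθ, smul_mul_assoc, ← smul_C, mul_smul_comm]; rfl)
    rw [h3, Algebra.smul_def]
    exact Q.mul_mem_left _ (hyQ z hz _ rfl)

theorem mem_killed {U Y Z : Submodule R S} {h : Y * Z ≤ U} {Q : Ideal (rees U)} {y : S} :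
    y ∈ killed h Q ↔
      y ∈ Y ∧ ∀ z ∈ Z, ∀ θ : rees U, (θ : S[X]) = X * C (y * z) → θ ∈ Q := Iff.rfl

/-- The use is contrapositive: if `Q` does not contain `Ut`, then `killed` is a proper submodule of
`Y`, which a general element avoids. -/
theorem reesGen_le_of_le_killed {U Y Z : Submodule R S} (h : Y * Z = U) {Q : Ideal (rees U)}
    (hY : Y ≤ killed h.le Q) {θ : rees U} (hθ : θ ∈ reesGen U) : θ ∈ Q := by
  obtain ⟨u, hu, huθ⟩ := mem_degOne.1 hθ
  rw [← h] at hu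
  have key : u ∈ Y * Z ∧ ∀ θ : rees U, (θ : S[X]) = X * C u → θ ∈ Q := by
    refine Submodule.mul_induction_on hu
      (fun y hy z hz => ⟨Submodule.mul_mem_mul hy hz, (hY hy).2 z hz⟩) ?_
    rintro u u' ⟨hu, huQ⟩ ⟨hu', huQ'⟩
    refine ⟨add_mem hu hu', fun θ hθ => ?_⟩
    have h1 := degOne_le_rees U (mem_degOne.2 ⟨_, h.le hu, rfl⟩)
    have h2 := degOne_le_rees U (mem_degOne.2 ⟨_, h.le hu', rfl⟩)
    have h3 : θ = ⟨_, h1⟩ + ⟨_, h2⟩ := Subtype.ext (by rw [hθ, C_add, mul_add]; rfl)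
    rw [h3]
    exact add_mem (huQ _ rfl) (huQ' _ rfl)
  exact key.2 θ huθ.symm

/-- If every prime over `J` contains `U t`, where `J` is generated by the ideal `I` of the base
ring and by submodules of `L t`, then a power of `U` is contained in `I U ^ n + L U ^ (n - 1)`. -/
theorem exists_pow_le {U L : Submodule R S} (hU : U.FG) {I : Ideal R} {J : Ideal (rees U)}
    {G : Set (rees U)} (hJ : J = Ideal.span ((algebraMap R (rees U)) '' I ∪ G))
    (hG : ∀ θ ∈ G, ∃ y ∈ L, (θ : S[X]) = X * C y)
    (h : ∀ Q : Ideal (rees U), Q.IsPrime → J ≤ Q → ∀ θ ∈ reesGen U, θ ∈ Q) :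
    ∃ n : ℕ, U ^ (n + 1) ≤ L * U ^ n ⊔ I • U ^ (n + 1) := by
  -- `T n` bounds the coefficients of `t ^ n` of elements of `J`. Degree zero is separate, since `L`
  -- only enters from degree one on.
  let T : ℕ → Submodule R S := fun n => match n with
    | 0 => I • 1
    | n + 1 => L * U ^ n ⊔ I • U ^ (n + 1)
  have hIT (n : ℕ) : I • U ^ n ≤ T n := by
    cases n with
    | zero => exact le_rfl
    | succ n => exact le_sup_right
  have hIU (i n : ℕ) : U ^ i * I • U ^ n ≤ I • U ^ (i + n) := by
    rw [Submodule.mul_le]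
    intro x hx y hy
    refine Submodule.smul_induction_on hy (fun r hr y hy => ?_) fun y y' hy hy' => ?_
    · rw [mul_smul_comm, pow_add]
      exact Submodule.smul_mem_smul hr (Submodule.mul_mem_mul hx hy)
    · rw [mul_add]
      exact add_mem hy hy'
  have hUT (i n : ℕ) : U ^ i * T n ≤ T (i + n) := by
    cases n with
    | zero =>
      refine le_trans ?_ (hIT _)
      have h0 := hIU i 0
      rw [pow_zero] at h0
      exact h0
    | succ n =>
      change U ^ i * (L * U ^ n ⊔ I • U ^ (n + 1)) ≤ L * U ^ (i + n) ⊔ I • U ^ (i + n + 1)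
      rw [Submodule.mul_sup]
      refine sup_le_sup ?_ (hIU i (n + 1))
      rw [pow_add, mul_left_comm]
  have hcoeff : ∀ f ∈ J, ∀ n, (f : S[X]).coeff n ∈ T n := by
    intro f hf
    rw [hJ] at hf
    induction hf using Submodule.span_induction with
    | mem f hf =>
      intro n
      rcases hf with ⟨r, hr, rfl⟩ | hf
      · rw [show ((algebraMap R (rees U) r : rees U) : S[X]) = algebraMap R S[X] r from rfl,
          Polynomial.algebraMap_apply, coeff_C]
        split_ifs with h
        · subst h
          rw [Algebra.algebraMap_eq_smul_one]
          exact Submodule.smul_mem_smul hr (Submodule.one_le.1 le_rfl)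
        · exact zero_mem _
      · obtain ⟨y, hy, hyf⟩ := hG f hf
        rw [hyf, X_mul, coeff_C_mul, coeff_X]
        split_ifs with h
        · subst h
          exact Submodule.mem_sup_left (by simpa using hy)
        · simp
    | zero => intro n; exact zero_mem _
    | add f g _ _ hf hg => intro n; exact add_mem (hf n) (hg n)
    | smul a f _ hf =>
      intro n
      rw [smul_eq_mul, show ((a * f : rees U) : S[X]) = a * f from rfl, coeff_mul]
      refine Submodule.sum_mem _ fun p hp => ?_
      rw [← Finset.HasAntidiagonal.mem_antidiagonal.1 hp]
      exact hUT _ _ (Submodule.mul_mem_mul (coeff_mem_pow a.2 _) (hf _))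
  have hfg : (Ideal.span (reesGen U : Set (rees U))).FG := by
    have h1 : (degOne U).FG := Submodule.FG.mul (Submodule.fg_span_singleton X) (hU.map _)
    have h2 : (reesGen U).FG := by
      refine Submodule.fg_of_fg_map_injective (rees U).val.toLinearMap Subtype.val_injective ?_
      rwa [map_reesGen]
    obtain ⟨s, hs⟩ := h2
    refine ⟨s, ?_⟩
    rw [← hs]
    exact (Submodule.span_span_of_tower R (rees U) (s : Set (rees U))).symm
  have hrad : Ideal.span (reesGen U : Set (rees U)) ≤ J.radical := by
    rw [Ideal.radical_eq_sInf]
    exact le_sInf fun Q hQ => Ideal.span_le.2 fun θ hθ => h Q hQ.2 hQ.1 θ hθ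
  obtain ⟨n, hn⟩ := Ideal.exists_pow_le_of_le_radical_of_fg hrad hfg
  -- A power of `Ut` lies in `J` because `Ut` lies in the radical; comparing coefficients in degree
  -- `n + 1` gives the inclusion.
  refine ⟨n, fun z hz => ?_⟩
  obtain ⟨θ, hθ, hθz⟩ := exists_mem_reesGen_pow hz
  have h3 (k : ℕ) : reesGen U ^ k ≤
      ((Ideal.span (reesGen U : Set (rees U))) ^ k).restrictScalars R := by
    induction k with
    | zero =>
      rw [pow_zero, pow_zero, Ideal.one_eq_top, Submodule.restrictScalars_top]
      exact le_top
    | succ k ih =>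
      rw [pow_succ, pow_succ, Submodule.mul_le]
      exact fun x hx y hy => Ideal.mul_mem_mul (ih hx) (Ideal.subset_span hy)
  have h4 := hcoeff θ (hn (Ideal.pow_le_pow_right (Nat.le_succ n) (h3 _ hθ))) (n + 1)
  rw [hθz] at h4
  simpa using h4

end Rees

/-! ### General elements and free joint reductions. -/

section Generic

variable {R : Type u} [CommRing R] {q : ℕ} {F : Fin q → Type v}
  [∀ k, AddCommGroup (F k)] [∀ k, Module R (F k)]

/-- The inclusion of the `k`-th summand in the symmetric algebra. -/
noncomputable def incl (R : Type u) [CommRing R] {q : ℕ} (F : Fin q → Type v)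
    [∀ k, AddCommGroup (F k)] [∀ k, Module R (F k)] (k : Fin q) :
    F k →ₗ[R] SymmetricAlgebra R (∀ j, F j) :=
  SymmetricAlgebra.ι R (∀ j, F j) ∘ₗ LinearMap.single R F k

/-- The product of the degree-one pieces of all the `M j`. -/
noncomputable def prodAll (M : ∀ k, Submodule R (F k)) :
    Submodule R (SymmetricAlgebra R (∀ j, F j)) :=
  ∏ j, symOne j (M j)

/-- The product of the degree-one pieces of the `M j` with `j ≠ k`. -/
noncomputable def prodErase (M : ∀ k, Submodule R (F k)) (k : Fin q) :
    Submodule R (SymmetricAlgebra R (∀ j, F j)) :=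
  ∏ j ∈ Finset.univ.erase k, symOne j (M j)

theorem symOne_mul_prodErase (M : ∀ k, Submodule R (F k)) (k : Fin q) :
    symOne k (M k) * prodErase M k = prodAll M :=
  Finset.mul_prod_erase _ (fun j => symOne j (M j)) (Finset.mem_univ k)

theorem fg_prodAll {M : ∀ k, Submodule R (F k)} (hM : ∀ k, (M k).FG) : (prodAll M).FG := by
  classical
  rw [prodAll]
  induction (Finset.univ : Finset (Fin q)) using Finset.induction_on with
  | empty => rw [Finset.prod_empty, Submodule.one_eq_span]; exact Submodule.fg_span_singleton 1
  | insert a s ha ih =>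
    rw [Finset.prod_insert ha]
    exact ((hM a).map _).mul ih

/-- The degree-one elements cut out by the chosen elements `b i`, `i ∈ D`. -/
def cutSet (M : ∀ k, Submodule R (F k)) {r : Fin q → ℕ} (D : Finset (Σ k, Fin (r k)))
    (b : ∀ i : Σ k, Fin (r k), F i.1) : Set (rees (prodAll M)) :=
  {θ | ∃ i ∈ D, ∃ z ∈ prodErase M i.1,
    (θ : (SymmetricAlgebra R (∀ j, F j))[X]) = X * C (incl R F i.1 (b i) * z)}

/-- The ideal of the Rees algebra generated by the maximal ideal and the chosen elements. -/
noncomputable def cutIdeal [IsLocalRing R] (M : ∀ k, Submodule R (F k)) {r : Fin q → ℕ}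
    (D : Finset (Σ k, Fin (r k))) (b : ∀ i : Σ k, Fin (r k), F i.1) :
    Ideal (rees (prodAll M)) :=
  Ideal.span ((algebraMap R (rees (prodAll M))) '' (maximalIdeal R) ∪ cutSet M D b)

theorem algebraMap_mem_cutIdeal [IsLocalRing R] {M : ∀ k, Submodule R (F k)} {r : Fin q → ℕ}
    {D : Finset (Σ k, Fin (r k))} {b : ∀ i : Σ k, Fin (r k), F i.1} {x : R}
    (hx : x ∈ maximalIdeal R) : algebraMap R (rees (prodAll M)) x ∈ cutIdeal M D b :=
  Ideal.subset_span (Or.inl ⟨x, hx, rfl⟩)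

variable [IsNoetherianRing R] [IsLocalRing R] [∀ k, Module.Finite R (F k)]

/-- The conditions under which chosen elements generate a joint reduction. -/
theorem isJointReduction_of_forall_prime {M : ∀ k, Submodule R (F k)}
    {b : ∀ i : Σ k, Fin (Module.finrank R (F k)), F i.1} (hb : ∀ i, b i ∈ M i.1)
    (h : ∀ Q : Ideal (rees (prodAll M)), Q.IsPrime → cutIdeal M Finset.univ b ≤ Q →
      ∀ θ ∈ reesGen (prodAll M), θ ∈ Q) :
    IsJointReduction M fun k => Submodule.span R (Set.range fun l => b ⟨k, l⟩) := by
  classical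
  have hBM (k) : Submodule.span R (Set.range fun l => b ⟨k, l⟩) ≤ M k := by
    rw [Submodule.span_le]
    rintro _ ⟨l, rfl⟩
    exact hb ⟨k, l⟩
  refine ⟨hBM, fun k => ⟨_, rfl⟩, ?_⟩
  set B : ∀ k, Submodule R (F k) := fun k => Submodule.span R (Set.range fun l => b ⟨k, l⟩)
  let L : Submodule R (SymmetricAlgebra R (∀ j, F j)) := ⨆ k, symOne k (B k) * prodErase M k
  have hUfg : (prodAll M).FG := fg_prodAll fun k => IsNoetherian.noetherian _
  obtain ⟨n, hn⟩ := exists_pow_le (L := L) hUfg (J := cutIdeal M Finset.univ b) rfl (by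
    rintro θ ⟨i, -, z, hz, hθ⟩
    refine ⟨_, Submodule.mem_iSup_of_mem i.1 (Submodule.mul_mem_mul ?_ hz), hθ⟩
    exact Submodule.mem_map_of_mem (Submodule.subset_span ⟨i.2, rfl⟩)) h
  have hLU : L ≤ prodAll M := iSup_le fun k =>
    (mul_le_mul' (Submodule.map_mono (hBM k)) le_rfl).trans (symOne_mul_prodErase M k).le
  -- Nakayama removes the term `𝔪 U ^ (n + 1)`.
  have h1 : prodAll M ^ (n + 1) = L * prodAll M ^ n := by
    refine le_antisymm ?_ (by rw [pow_succ']; exact mul_le_mul' hLU le_rfl)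
    exact Submodule.le_of_le_smul_of_le_jacobson_bot (hUfg.pow _) (maximalIdeal_le_jacobson _) hn
  refine ⟨n, ?_⟩
  have h2 : ∏ j, symPow j (M j) (n + 1) = prodAll M ^ (n + 1) := Finset.prod_pow _ _ _
  rw [h2, h1, Submodule.iSup_mul]
  refine iSup_congr fun k => ?_
  have h3 : prodAll M ^ n = symPow k (M k) n * prodErase M k ^ n := by
    rw [← symOne_mul_prodErase M k, mul_pow]
    rfl
  have h4 : ∏ j ∈ Finset.univ.erase k, symPow j (M j) (n + 1) = prodErase M k ^ (n + 1) :=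
    Finset.prod_pow _ _ _
  rw [h3, h4, pow_succ']
  ring

variable [Infinite (ResidueField R)] [∀ k, Module.Free R (F k)]

/-- Choice of general elements: their determinants avoid the associated primes of `R`, and the
primes of the Rees algebra containing them lie above long chains of primes. -/
theorem exists_generic {M : ∀ k, Submodule R (F k)} (hM : ∀ k, IsFiniteLength R (F k ⧸ M k))
    (hass : ∀ p ∈ associatedPrimes R R, p ≠ maximalIdeal R)
    (D : Finset (Σ k, Fin (Module.finrank R (F k)))) :
    ∃ b : ∀ i : Σ k, Fin (Module.finrank R (F k)), F i.1, (∀ i, b i ∈ M i.1) ∧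
      (∀ k, ∀ p ∈ associatedPrimes R R, ∃ y : Fin (Module.finrank R (F k)) → F k,
        (∀ j, y j ∈ M k) ∧ (∀ j, (⟨k, j⟩ : Σ k, Fin (Module.finrank R (F k))) ∈ D →
          y j = b ⟨k, j⟩) ∧ (Module.finBasis R (F k)).det y ∉ p) ∧
      ∀ Q : Ideal (rees (prodAll M)), Q.IsPrime → cutIdeal M D b ≤ Q →
        (∃ θ ∈ reesGen (prodAll M), θ ∉ Q) → HasChain (maximalIdeal R) D.card Q := by
  classical
  have : IsNoetherianRing (rees (prodAll M)) :=
    isNoetherianRing_rees (fg_prodAll fun k => IsNoetherian.noetherian _)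
  induction D using Finset.induction_on with
  | empty =>
    refine ⟨fun _ => 0, fun i => zero_mem _, fun k p hp => ?_, fun Q _ _ _ => trivial⟩
    obtain ⟨c, hc⟩ := exists_pow_smul_top_le (hM k)
    have hpp : p.IsPrime := hp.1
    -- With nothing chosen yet, some determinant of elements of `M k` avoids `p`, because `p ≠ 𝔪`
    -- cannot contain the Fitting ideal.
    obtain ⟨x, hx, hxp⟩ := fittingIdeal_not_le hc (Module.finBasis R (F k)) (hass p hp)
    rw [fittingIdeal_eq_span _ (Module.finBasis R (F k))] at hx
    by_contra! hcon
    refine hxp (Ideal.span_le.2 ?_ hx)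
    rintro _ ⟨m, hm, rfl⟩
    exact hcon m hm (fun j hj => absurd hj (Finset.notMem_empty _))
  | insert i D hi ih =>
    obtain ⟨b, hbM, hdet, hchain⟩ := ih
    obtain ⟨k, l⟩ := i
    choose! y hyM hyb hyp using hdet
    -- The new element must avoid two finite families of submodules not containing `M k`. `𝒩₁` holds
    -- the vectors which, put in slot `l`, send the determinant of the current completion into an
    -- associated prime; `𝒩₂` holds the vectors whose products with the cofactor `prodErase M k`
    -- stay in a relevant minimal prime of the current cut ideal.
    let 𝒩₁ : Set (Submodule R (F k)) := Set.range fun p : associatedPrimes R R =>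
      Submodule.comap (detAt (Module.finBasis R (F k)) (y k p) l) (p.1 : Submodule R R)
    let 𝒩₂ : Set (Submodule R (F k)) :=
      (fun Q => (killed (symOne_mul_prodErase M k).le Q).comap (incl R F k)) ''
        {Q | Q ∈ (cutIdeal M D b).minimalPrimes ∧ ∃ θ ∈ reesGen (prodAll M), θ ∉ Q}
    have hfin : (𝒩₁ ∪ 𝒩₂).Finite := by
      have := (associatedPrimes.finite R R).to_subtype
      refine (Set.finite_range _).union (Set.Finite.image _ ?_)
      exact (Ideal.finite_minimalPrimes_of_isNoetherianRing _ (cutIdeal M D b)).subset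
        fun Q hQ => hQ.1
    obtain ⟨v, hvM, hv⟩ := exists_mem_forall_notMem (IsNoetherian.noetherian (M k)) hfin (by
      rintro N (⟨p, rfl⟩ | ⟨Q, ⟨-, θ, hθ, hθQ⟩, rfl⟩) hle
      · refine hyp k p p.2 ?_
        have := hle (hyM k p p.2 l)
        rw [Submodule.mem_comap, detAt_self, if_pos rfl] at this
        exact this
      · exact hθQ (reesGen_le_of_le_killed (symOne_mul_prodErase M k)
          (Submodule.map_le_iff_le_comap.2 hle) hθ))
    have hne : ∀ i ∈ D, Function.update b ⟨k, l⟩ v i = b i := fun i hiD =>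
      Function.update_of_ne (fun h => hi (by rwa [← h])) _ _
    refine ⟨Function.update b ⟨k, l⟩ v, fun i => ?_, fun k' p hp => ?_, fun Q hQ hcut hrel => ?_⟩
    · by_cases h : i = ⟨k, l⟩
      · subst h
        rwa [Function.update_self]
      · rw [Function.update_of_ne h]
        exact hbM i
    · by_cases hk : k' = k
      · subst hk
        refine ⟨Function.update (y k' p) l v, fun j => ?_, fun j hj => ?_, ?_⟩
        · by_cases h : j = l
          · subst h; simpa using hvM
          · rw [Function.update_of_ne h]; exact hyM k' p hp j
        · by_cases h : j = l
          · subst h; simp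
          · have hj' := (Finset.mem_insert.1 hj).resolve_left (fun h' => h (by simpa using h'))
            rw [Function.update_of_ne h, hne _ hj']
            exact hyb k' p hp j hj'
        · exact hv _ (Or.inl ⟨⟨p, hp⟩, rfl⟩)
      · refine ⟨y k' p, hyM k' p hp, fun j hj => ?_, hyp k' p hp⟩
        have hj' := (Finset.mem_insert.1 hj).resolve_left
          (fun h' => hk (congrArg Sigma.fst h'))
        rw [hne _ hj']
        exact hyb k' p hp j hj'
    · have hle : cutIdeal M D b ≤ cutIdeal M (insert ⟨k, l⟩ D) (Function.update b ⟨k, l⟩ v) := by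
        refine Ideal.span_mono (Set.union_subset_union_right _ ?_)
        rintro θ ⟨i, hiD, z, hz, hθ⟩
        exact ⟨i, Finset.mem_insert_of_mem hiD, z, hz, by rw [hne i hiD]; exact hθ⟩
      -- A minimal prime `Q'` of the old cut ideal below `Q` is the next member of the chain: some
      -- `v z t` lies in `Q` but, by the choice of `v`, not in `Q'`.
      obtain ⟨Q', hQ', hQQ⟩ := Ideal.exists_minimalPrimes_le (hle.trans hcut)
      have hrel' : ∃ θ ∈ reesGen (prodAll M), θ ∉ Q' := by
        obtain ⟨θ, hθ, hθQ⟩ := hrel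
        exact ⟨θ, hθ, fun h => hθQ (hQQ h)⟩
      have hvQ := hv _ (Or.inr ⟨Q', ⟨hQ', hrel'⟩, rfl⟩)
      have hvY : incl R F k v ∈ symOne k (M k) := Submodule.mem_map_of_mem hvM
      rw [Submodule.mem_comap, mem_killed] at hvQ
      push Not at hvQ
      obtain ⟨z, hz, θ, hθ, hθQ'⟩ := hvQ hvY
      rw [Finset.card_insert_of_notMem hi]
      refine ⟨Q', hQ'.1.1, fun r hr => hQ'.1.2 (algebraMap_mem_cutIdeal hr), hQQ,
        ⟨θ, ?_, hcut (Ideal.subset_span (Or.inr ?_)), hθQ'⟩, hchain Q' hQ'.1.1 hQ'.1.2 hrel'⟩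
      · exact mem_degOne.2 ⟨_, (symOne_mul_prodErase M k).le (Submodule.mul_mem_mul hvY hz),
          hθ.symm⟩
      · exact ⟨⟨k, l⟩, Finset.mem_insert_self _ _, z, hz, by rw [Function.update_self]; exact hθ⟩

/-- Existence of free joint reductions. -/
theorem exists_isJointReduction_free {M : ∀ k, Submodule R (F k)}
    (hM : ∀ k, IsFiniteLength R (F k ⧸ M k)) {d : ℕ} (hd : ringKrullDim R = d) (hdq : d ≤ q)
    {x : R} (hxm : x ∈ maximalIdeal R) (hx : x ∈ nonZeroDivisors R) :
    ∃ B : ∀ k, Submodule R (F k), IsJointReduction M B ∧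
      ∀ k, Module.Free R (B k) ∧ Module.finrank R (B k) = Module.finrank R (F k) := by
  classical
  have hass : ∀ p ∈ associatedPrimes R R, p ≠ maximalIdeal R := by
    rintro p hp rfl
    have h1 : x ∈ ⋃ p ∈ associatedPrimes R R, (p : Set R) := Set.mem_biUnion hp hxm
    rw [biUnion_associatedPrimes_eq_compl_nonZeroDivisors] at h1
    exact h1 hx
  obtain ⟨b, hbM, hdet, hchain⟩ := exists_generic hM hass Finset.univ
  refine ⟨_, isJointReduction_of_forall_prime hbM fun Q hQ hcut => ?_, fun k => ?_⟩
  · by_contra! hrel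
    -- A summand of rank zero forces `U = 0`, and then no prime can miss `Ut`. Positivity keeps the
    -- truncated subtraction in `∑ (r_k - 1)` exact.
    have hr : ∀ k, 0 < Module.finrank R (F k) := by
      intro k
      by_contra h0
      have h0 : Module.finrank R (F k) = 0 := by omega
      have hsub : Subsingleton (F k) := (Module.finrank_eq_zero_iff_of_free R _).1 h0
      obtain ⟨θ, hθ, hθQ⟩ := hrel
      obtain ⟨u, hu, huθ⟩ := mem_degOne.1 hθ
      have h1 : symOne k (M k) = ⊥ := by
        rw [symOne, Subsingleton.elim (M k) ⊥, Submodule.map_bot]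
      rw [← symOne_mul_prodErase M k, h1, Submodule.bot_mul, Submodule.mem_bot] at hu
      have h2 : θ = 0 := Subtype.ext (by rw [← show X * C u = (θ : _[X]) from huθ, hu]; simp)
      exact hθQ (h2 ▸ zero_mem _)
    have hcM : ∃ c : ℕ, maximalIdeal R ^ c • prodAll (fun k => (⊤ : Submodule R (F k))) ≤
        prodAll M := by
      choose c hc using fun k => exists_pow_smul_top_le (hM k)
      rw [prodAll, prodAll]
      induction (Finset.univ : Finset (Fin q)) using Finset.induction_on with
      | empty => exact ⟨0, by simp⟩
      | insert a s ha ih =>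
        obtain ⟨c', hc'⟩ := ih
        refine ⟨c a + c', ?_⟩
        rw [Finset.prod_insert ha, Finset.prod_insert ha, pow_add]
        refine (mul_smul_mul_le _ _ _ _).trans (mul_le_mul' ?_ hc')
        rw [symOne, ← Submodule.map_smul'']
        exact Submodule.map_mono (hc a)
    obtain ⟨c, hc⟩ := hcM
    refine not_hasChain hd hxm ?_ (E := prodAll fun k => (⊤ : Submodule R (F k))) ?_ hc
      (g := ∑ k, (Module.finrank R (F k) - 1)) ?_ Q
      (fun r hr => hcut (algebraMap_mem_cutIdeal hr)) hrel ?_ (hchain Q hQ hcut hrel)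
    · intro s hs
      exact Module.Flat.isSMulRegular_of_nonZeroDivisors hx (by simpa using hs)
    · exact Finset.prod_le_prod' fun k _ => Submodule.map_mono le_top
    · intro n
      rw [prodAll, ← Finset.prod_pow]
      rw [← Finset.prod_pow_eq_pow_sum]
      refine exists_finset_span_prod _ _ _ fun k => ?_
      obtain ⟨r, hr⟩ : ∃ r, Module.finrank R (F k) = r + 1 :=
        ⟨_, (Nat.succ_pred_eq_of_pos (hr k)).symm⟩
      let e : Module.Basis (Fin (r + 1)) R (F k) := Module.finBasisOfFinrankEq R (F k) hr
      obtain ⟨s, hs, hspan⟩ := exists_finset_span_pow (R := R) r (fun i => incl R F k (e i)) n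
      refine ⟨s, by rw [hr]; exact hs, ?_⟩
      rw [← hspan, symOne, ← e.span_eq, Submodule.map_span, ← Set.range_comp]
      rfl
    -- The count `∑ (r_k - 1) + d ≤ ∑ r_k` is where `d ≤ q` enters.
    · rw [Finset.card_univ, Fintype.card_sigma]
      simp only [Fintype.card_fin]
      have : ∑ k, Module.finrank R (F k) = ∑ k, ((Module.finrank R (F k) - 1) + 1) :=
        Finset.sum_congr rfl fun k _ => (Nat.sub_add_cancel (hr k)).symm
      rw [this, Finset.sum_add_distrib]
      simpa using hdq
  · let y : Fin (Module.finrank R (F k)) → F k := fun l => b ⟨k, l⟩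
    -- All slots are now chosen, so the completion provided for each associated prime is `y` itself.
    have hnz : (Module.finBasis R (F k)).det y ∈ nonZeroDivisors R := by
      by_contra hcon
      have h1 : (Module.finBasis R (F k)).det y ∈ ((nonZeroDivisors R : Set R))ᶜ := hcon
      rw [← biUnion_associatedPrimes_eq_compl_nonZeroDivisors] at h1
      obtain ⟨p, hp, hmem⟩ := Set.mem_iUnion₂.1 h1
      obtain ⟨y', -, hyb, hyp⟩ := hdet k p hp
      have hy : y' = y := funext fun j => hyb j (Finset.mem_univ _)
      rw [hy] at hyp
      exact hyp hmem
    have hli : LinearIndependent R y := by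
      rw [Fintype.linearIndependent_iff]
      intro c hc j
      have h1 := detAt_sum (Module.finBasis R (F k)) y j c
      rw [hc, map_zero] at h1
      exact (mul_right_mem_nonZeroDivisors_eq_zero_iff hnz).1 h1.symm
    exact ⟨Module.Free.of_basis (Module.Basis.span hli),
      (finrank_span_eq_card hli).trans (Fintype.card_fin _)⟩

end Generic

theorem exists_mem_nonZeroDivisors_of_depth_pos {R : Type*} [CommRing R] [IsLocalRing R]
    (h : 0 < depth R) : ∃ x ∈ IsLocalRing.maximalIdeal R, x ∈ nonZeroDivisors R := by
  rw [depth] at h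
  simp only [lt_iSup_iff] at h
  obtain ⟨rs, hrs, hreg, hlen⟩ := h
  cases rs with
  | nil => simp at hlen
  | cons x rs =>
    refine ⟨x, hrs x List.mem_cons_self, ?_⟩
    have hx := ((RingTheory.Sequence.isRegular_cons_iff R x rs).1 hreg).1
    rw [mem_nonZeroDivisors_iff_right]
    intro y hy
    exact hx.right_eq_zero_of_smul (by rwa [smul_eq_mul, mul_comm])

end JointReduction

theorem mainTheorem5 {R : Type*} [CommRing R] [IsNoetherianRing R] [IsLocalRing R]
    [Infinite (IsLocalRing.ResidueField R)]
    (d : ℕ) (hd : ringKrullDim R = d) (hd_pos : 0 < d)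
    (q : ℕ) (F : Fin q → Type*) [∀ k, AddCommGroup (F k)] [∀ k, Module R (F k)]
    [∀ k, Module.Free R (F k)] [∀ k, Module.Finite R (F k)]
    (M : ∀ k, Submodule R (F k)) (hM : ∀ k, IsFiniteLength R (F k ⧸ M k)) :
    (q = d → (∀ k, M k ≠ ⊤) →
      ∀ B : ∀ k, Submodule R (F k), JointReduction.IsJointReduction M B → ∀ k,
        (∀ x : R, JointReduction.IsDetOf (B k) x →
          ∃ S : Set R, x ∈ S ∧
            JointReduction.IsMinGenSet (JointReduction.fittingIdeal (M k)) S) ∧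
        (∀ S : Set (F k), JointReduction.IsMinGenSet (B k) S →
          ∃ T : Set (F k), S ⊆ T ∧ JointReduction.IsMinGenSet (M k) T)) ∧
    (d ≤ q → 0 < JointReduction.depth R →
      ∃ B : ∀ k, Submodule R (F k), JointReduction.IsJointReduction M B ∧
        ∀ k, Module.Free R (B k) ∧
          Module.finrank R (B k) = Module.finrank R (F k)) := by
  constructor
  · rintro rfl hM' B hB k
    exact hB.minGenSet_extends hd hM hM' k
  · intro hdq hdepth
    obtain ⟨x, hxm, hx⟩ := JointReduction.exists_mem_nonZeroDivisors_of_depth_pos hdepth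
    exact JointReduction.exists_isJointReduction_free hM hd hdq hxm hx
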